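/- Let $A$ be a self-adjoint operator in a complex Hilbert space $\mathcal H$ which is bounded or semi-bounded from below. Put $m=\min\sigma(A)$, let $\mathfrak a$ be the quadratic form of $A$, so $\mathrm{Dom}(\mathfrak a)=\mathrm{Dom}((A-m+1)^{1/2})$, and let $\|u\|_{\mathfrak a}=(\mathfrak a[u,u]-(m-1)\langle u,u\rangle)^{1/2}=\|(A-m+1)^{1/2}u\|$. Let $a<b$ be real numbers in the resolvent set of $A$ with $\sigma_{\mathrm{ess}}(A)\cap[a,b]=\varnothing$, let $\Delta=[a,b]$, and suppose that $\sigma(A)\cap\Delta=\{\lambda_1,\dots,\lambda_d\}$ is non-empty. Let $\mathcal L(\Delta)$ be the span of the eigenvectors of $A$ with eigenvalues in $\Delta$, and $E$ the orthogonal projection of $\mathcal H$ onto $\mathcal L(\Delta)$. Let $(\mathcal L_n)$ be a sequence of finite-dimensional subspaces of $\mathrm{Dom}(\mathfrak a)$ such that for every $u\in\mathrm{Dom}(\mathfrak a)$ there are $u_n\in\mathcal L_n$ with $\|u-u_n\|_{\mathfrak a}\to0$. For a subspace $\mathcal K\subset\mathrm{Dom}(\mathfrak a)$, let $\sigma(A,\mathcal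 K)$ be the set of those $\mu\in\mathbb R$ for which there is a non-zero $u\in\mathcal K$ with $\mathfrak a[u,v]=\mu\langle u,v\rangle$ for all $v\in\mathcal K$. Let $\mathcal L_n(\Delta)$ be the span of all such $u$ for $\mathcal K=\mathcal L_n$ and $\mu\in\Delta$, and let $Q_n$ be the orthogonal projection of $\mathcal H$ onto $\mathcal L_n(\Delta)$. For subspaces $\mathcal K,\mathcal M$ of $\mathcal H$ let $\delta(\mathcal K,\mathcal M)=\sup_{u\in\mathcal K,\|u\|=1}\mathrm{dist}(u,\mathcal M)$ (which is $0$ if $\mathcal K=\{0\}$) and $\hat\delta(\mathcal K,\mathcal M)=\max\{\delta(\mathcal K,\mathcal M),\delta(\mathcal M,\mathcal K)\}$; let $\hat\delta_{\mathfrak a}$ be the same quantity for subspaces of $\mathrm{Dom}(\mathfrak a)$ with the norm $\|\cdot\|_{\mathfrak a}$. Let $d_H$ be the Hausdorff distance. Then there exists $N\in\mathbb N$ such that for every $k\ge N$ the following holds. Let $P$ be the orthogonal projection of $\mathcal H$ onto $\mathcal L:=\mathcal L_k$. The minimum $\gamma:=\min\big(\sigma_{\mathrm{dis}}(EPE)\setminus\{0\}\big)$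 exists and $\gamma>0$ (if $\mathcal H$ is infinite-dimensional, then $0\notin\sigma_{\mathrm{dis}}(EPE)$). For $n\in\mathbb N$ let $\mathcal M_n$ be the spectral subspace of the self-adjoint operator $Q_nP|_{\mathcal L_n(\Delta)}$ on $\mathcal L_n(\Delta)$ associated to the interval $[\gamma/2,1]$. Then, as $n\to\infty$, \[ \hat\delta(\mathcal M_n,\mathcal L(\Delta))\to0,\qquad \hat\delta_{\mathfrak a}(\mathcal M_n,\mathcal L(\Delta))\to0,\qquad d_H\big(\sigma(A,\mathcal M_n),\{\lambda_1,\dots,\lambda_d\}\big)\to0 . \] -/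

import Mathlib

open Filter Topology Set

noncomputable section

namespace GalerkinSpectral

variable {H : Type*} [NormedAddCommGroup H] [InnerProductSpace ℂ H]

/-! ### Spectral notions for (possibly unbounded) operators -/

/-- `R` is the bounded, everywhere defined inverse of `T - z`. -/
def IsResolventAt (T : H →ₗ.[ℂ] H) (z : ℂ) (R : H →L[ℂ] H) : Prop :=
  (∀ x : H, ∃ h : R x ∈ T.domain, T ⟨R x, h⟩ - z • R x = x) ∧
    ∀ u : T.domain, R (T u - z • (u : H)) = u

/-- The resolvent set `ρ(T)`. -/
def resSet (T : H →ₗ.[ℂ] H) : Set ℂ := {z | ∃ R : H →L[ℂ] H, IsResolventAt T z R}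

open Classical in
/-- The resolvent `(T - z)⁻¹` for `z ∈ ρ(T)` (and `0` otherwise). -/
def res (T : H →ₗ.[ℂ] H) (z : ℂ) : H →L[ℂ] H :=
  if h : ∃ R : H →L[ℂ] H, IsResolventAt T z R then h.choose else 0

/-- The spectrum `σ(T)`. -/
def spec (T : H →ₗ.[ℂ] H) : Set ℂ := (resSet T)ᶜ

/-- The eigenspace `ker (T - z)`, as a subspace of `H`. -/
def eigSpace (T : H →ₗ.[ℂ] H) (z : ℂ) : Submodule ℂ H :=
  (LinearMap.ker (T.toFun - z • T.domain.subtype)).map T.domain.subtype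

/-- The discrete spectrum of a self-adjoint operator: isolated points of the spectrum that are
eigenvalues of finite multiplicity. -/
def discSpec (T : H →ₗ.[ℂ] H) : Set ℂ :=
  {z | (∃ ε > 0, spec T ∩ Metric.ball z ε = {z}) ∧ eigSpace T z ≠ ⊥ ∧
    FiniteDimensional ℂ (eigSpace T z)}

/-- The essential spectrum of a self-adjoint operator. -/
def essSpec (T : H →ₗ.[ℂ] H) : Set ℂ := spec T \ discSpec T

/-- The real points of a set of complex numbers. All spectra below are spectra of self-adjoint
operators, so they consist of real points only. -/
def realPts (S : Set ℂ) : Set ℝ := (fun x : ℝ => (x : ℂ)) ⁻¹' S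

/-- The span of all eigenvectors of `T` with eigenvalues in the set `I` of real numbers. -/
def eigSpan (T : H →ₗ.[ℂ] H) (I : Set ℝ) : Submodule ℂ H :=
  ⨆ μ ∈ I, eigSpace T (μ : ℂ)

/-- The orthogonal projection onto (the closure of) `K`; it is only used for finite-dimensional
`K`, see `orthProj_eq`. -/
def orthProj [CompleteSpace H] (K : Submodule ℂ H) : H →L[ℂ] H :=
  K.topologicalClosure.starProjection

theorem orthProj_eq [CompleteSpace H] (K : Submodule ℂ H) [FiniteDimensional ℂ K] :
    orthProj K = K.starProjection := by
  unfold orthProj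
  congr 1
  exact (Submodule.closed_of_finiteDimensional K).submodule_topologicalClosure_eq

/-- The gap `δ(K, M)`, the supremum over `u ∈ K` with `N u = 1` of the distance from `u` to `M`,
where lengths are measured by the norm `N` (the supremum of the empty set being `0`). -/
def gap {V : Type*} [AddCommGroup V] [Module ℂ V] (N : V → ℝ) (K M : Submodule ℂ V) : ℝ :=
  sSup {r | ∃ u ∈ K, N u = 1 ∧ r = ⨅ v : M, N (u - v)}

/-- The symmetric gap: the maximum of `δ(K, M)` and `δ(M, K)`. -/
def symGap {V : Type*} [AddCommGroup V] [Module ℂ V] (N : V → ℝ) (K M : Submodule ℂ V) : ℝ :=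
  max (gap N K M) (gap N M K)

/-! ### The quadratic form of a self-adjoint operator that is bounded below -/

section Form

variable [CompleteSpace H]

/-- `m = min σ(A)`. -/
def specMin (A : H →ₗ.[ℂ] H) : ℝ := sInf (realPts (spec A))

/-- The operator `(A - m + 1)^{1/2}`, as the inverse of the positive square root of the bounded
positive operator `(A - (m - 1))⁻¹`. -/
def sqrtShift (A : H →ₗ.[ℂ] H) : H →ₗ.[ℂ] H :=
  ((CFC.sqrt (res A ((specMin A - 1 : ℝ) : ℂ)) : H →L[ℂ] H).toLinearMap.toPMap ⊤).inverse

/-- The form domain `Dom(𝔞) = Dom((A - m + 1)^{1/2})`. -/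
abbrev formDom (A : H →ₗ.[ℂ] H) : Submodule ℂ H := (sqrtShift A).domain

/-- The form `𝔞[u, v] = ⟪(A-m+1)^{1/2} u, (A-m+1)^{1/2} v⟫ + (m - 1) ⟪u, v⟫`
(conjugate-linear in the first argument, as is Mathlib's inner product). -/
def form (A : H →ₗ.[ℂ] H) (u v : formDom A) : ℂ :=
  inner ℂ (sqrtShift A u) (sqrtShift A v) + ((specMin A - 1 : ℝ) : ℂ) * inner ℂ (u : H) (v : H)

/-- The form norm `‖u‖_𝔞 = (𝔞[u, u] - (m - 1) ⟪u, u⟫)^{1/2}`. -/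
def formNorm (A : H →ₗ.[ℂ] H) (u : formDom A) : ℝ :=
  Real.sqrt ((form A u u).re - (specMin A - 1) * ‖(u : H)‖ ^ 2)

/-- The symmetric gap of subspaces of the form domain with respect to the form norm. -/
def formSymGap (A : H →ₗ.[ℂ] H) (K M : Submodule ℂ H) : ℝ :=
  symGap (formNorm A) (K.comap (formDom A).subtype) (M.comap (formDom A).subtype)

/-! ### The Galerkin method, for trial spaces `K ≤ formDom A` -/

/-- `u ∈ K` and `𝔞[u, v] = μ ⟪u, v⟫` for all `v ∈ K`. -/
def IsGalerkinSol (A : H →ₗ.[ℂ] H) (K : Submodule ℂ H) (μ : ℝ) (u : formDom A) : Prop :=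
  (u : H) ∈ K ∧ ∀ v : formDom A, (v : H) ∈ K → form A u v = (μ : ℂ) * inner ℂ (u : H) (v : H)

/-- The set `σ(A, K)` of Galerkin eigenvalues. -/
def galerkinSpec (A : H →ₗ.[ℂ] H) (K : Submodule ℂ H) : Set ℝ :=
  {μ | ∃ u : formDom A, u ≠ 0 ∧ IsGalerkinSol A K μ u}

/-- The Galerkin spectral subspace `K(I)`: the span of the Galerkin eigenvectors whose
eigenvalues belong to `I`. -/
def galerkinSpan (A : H →ₗ.[ℂ] H) (K : Submodule ℂ H) (I : Set ℝ) : Submodule ℂ H :=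
  Submodule.span ℂ ((fun u : formDom A => (u : H)) '' {u | ∃ μ ∈ I, IsGalerkinSol A K μ u})

/-- The operator `E P E`, where `E` and `P` are the orthogonal projections onto `𝓛(I)` (the
eigenspace of `A` for the eigenvalues in `I`) and onto `L`. -/
def compressedProj (A : H →ₗ.[ℂ] H) (I : Set ℝ) (L : Submodule ℂ H) : H →ₗ.[ℂ] H :=
  (orthProj (eigSpan A I) ∘L orthProj L ∘L orthProj (eigSpan A I)).toLinearMap.toPMap ⊤

/-- The spectral subspace, for the interval `[γ/2, 1]`, of the operator `Q P` restricted to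
`K(I)`, where `Q` and `P` are the orthogonal projections onto `K(I)` and onto `L`. -/
def filteredSpace (A : H →ₗ.[ℂ] H) (I : Set ℝ) (L K : Submodule ℂ H) (γ : ℝ) :
    Submodule ℂ H :=
  eigSpan ((orthProj (galerkinSpan A K I) ∘L orthProj L).toLinearMap.toPMap (galerkinSpan A K I))
    (Icc (γ / 2) 1)

end Form

end GalerkinSpectral

end

/-!
All lengths and spectra are moved to the bounded operator `R = (A - m + 1)⁻¹`, for which
`0 ≤ R ≤ 1`, and its square root `S`. The form domain is the range of `S`, with `‖S x‖_𝔞 = ‖x‖`. A Galerkin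
eigenvector `S x` with eigenvalue `μ` for the trial space `𝓛ₙ` is an eigenvector `x` of the
compression `Rₙ` of `R` to `Kₙ = S⁻¹ 𝓛ₙ` with eigenvalue `τ = 1 / (μ - m + 1)`
(`isGalerkinSol_iff`), and `[a, b]` corresponds to an interval `[α, β]` with `α > 0` whose end
points are not in the spectrum of `R`. The assumption on the trial spaces says that the orthogonal
projections onto `Kₙ` converge strongly to `1`, so `Rₙ → R` strongly.

Strong convergence of self-adjoint operators implies strong convergence of the spectral projections
for an interval with end points outside the limit spectrum (`specProj_tendsto`). So the spectral
projections onto `Wₙ`, the spectral subspace of `Rₙ` for `[α, β]`, converge strongly to the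
projection onto `E = 𝓛(Δ)`. As `𝓛ₙ(Δ) = S Wₙ` and `S` is bounded below on `Wₙ` by `√α`, the same
holds for the projections `Qₙ` onto `𝓛ₙ(Δ)` (`starProjection_map_tendsto`). This does not bound the
distance from `𝓛ₙ(Δ)` to `E`: there may be spurious eigenvectors. They tend weakly to zero, and the
fixed projection `P` of finite rank removes them, since `Qₙ P → E P` in norm
(`filterOp_subClose`). This gives convergence of the gap in the norm of the space.

Convergence in the form norm follows since `Mₙ` is a subspace of `S Wₙ`, where the two norms are
comparable (`subClose_comap`). The Galerkin eigenvalues in `Mₙ` are the Ritz values of `R` in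
`S⁻¹ Mₙ`; this space is close to `E`, so that Ritz vectors are approximate eigenvectors of `R`
in `E` and vice versa (`exists_spectrum_near_ritz`, `exists_ritz_near_spectrum`).
-/

noncomputable section

namespace GalerkinSpectral

variable {H : Type*} [NormedAddCommGroup H] [InnerProductSpace ℂ H]

/-! ### Spectral projections of bounded self-adjoint operators -/

section SpecProj

variable {T : H →L[ℂ] H} {s t : Set ℝ}

/-- The set `s` splits the real spectrum of `T` into two closed parts. -/
def Separated (T : H →L[ℂ] H) (s : Set ℝ) : Prop :=
  IsClosed (spectrum ℝ T ∩ s) ∧ IsClosed (spectrum ℝ T \ s)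

/-- The span of the eigenvectors of `T` with eigenvalues in `s`. -/
def eigSup (T : H →L[ℂ] H) (s : Set ℝ) : Submodule ℂ H :=
  ⨆ τ ∈ s, Module.End.eigenspace (T : H →ₗ[ℂ] H) (τ : ℂ)

lemma Separated.compl (h : Separated T s) : Separated T sᶜ := by
  refine ⟨by simpa [← sdiff_eq] using h.2, by simpa [sdiff_eq] using h.1⟩

lemma Separated.continuousOn (h : Separated T s) :
    ContinuousOn (s.indicator (1 : ℝ → ℝ)) (spectrum ℝ T) := by
  rw [← inter_union_sdiff (spectrum ℝ T) s]
  refine ContinuousOn.union_of_isClosed ?_ ?_ h.1 h.2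
  · exact (continuousOn_const (c := (1 : ℝ))).congr fun x hx => by simp [hx.2]
  · exact (continuousOn_const (c := (0 : ℝ))).congr fun x hx => by simp [hx.2]

lemma separated_of_finite (h : (spectrum ℝ T).Finite) (s : Set ℝ) : Separated T s :=
  ⟨(h.subset inter_subset_left).isClosed, (h.subset sdiff_subset).isClosed⟩

lemma Separated.mono (h : Separated T s) (hfin : (spectrum ℝ T ∩ s).Finite) (hts : t ⊆ s) :
    Separated T t := by
  refine ⟨(hfin.subset (inter_subset_inter_right _ hts)).isClosed, ?_⟩
  have : spectrum ℝ T \ t = (spectrum ℝ T \ s) ∪ ((spectrum ℝ T ∩ s) \ t) := by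
    ext x; constructor
    · rintro ⟨h1, h2⟩; by_cases hx : x ∈ s
      · exact Or.inr ⟨⟨h1, hx⟩, h2⟩
      · exact Or.inl ⟨h1, hx⟩
    · rintro (⟨h1, h2⟩ | ⟨h1, h2⟩)
      · exact ⟨h1, fun h => h2 (hts h)⟩
      · exact ⟨h1.1, h2⟩
  rw [this]
  exact h.2.union (hfin.subset sdiff_subset).isClosed

lemma mem_spectrum_of_eigen {τ : ℝ} {x : H} (hx : x ≠ 0) (h : T x = (τ : ℂ) • x) :
    τ ∈ spectrum ℝ T := by
  rw [spectrum.mem_iff]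
  intro hu
  apply hx
  obtain ⟨v, hv⟩ := hu
  have h1 : (v : H →L[ℂ] H) x = 0 := by
    rw [hv]
    change (τ : ℝ) • x - T x = 0
    rw [h]; simp
  have h2 : ((v⁻¹ : (H →L[ℂ] H)ˣ) : H →L[ℂ] H) ((v : H →L[ℂ] H) x) = x :=
    congr($(v.inv_mul) x)
  rw [← h2, h1, map_zero]

lemma mem_eigSup_of_eigen {τ : ℝ} (hτ : τ ∈ s) {x : H} (hx : T x = (τ : ℂ) • x) :
    x ∈ eigSup T s :=
  Submodule.mem_iSup_of_mem τ <| Submodule.mem_iSup_of_mem hτ <| by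
    simpa [Module.End.mem_eigenspace_iff] using hx

lemma finite_real_spectrum (h : (spectrum ℂ T).Finite) : (spectrum ℝ T).Finite := by
  have : spectrum ℝ T ⊆ (fun x : ℝ => (x : ℂ)) ⁻¹' spectrum ℂ T := fun x hx =>
    (spectrum.algebraMap_mem_iff ℂ (a := T) (r := x)).2 hx
  exact (h.preimage Complex.ofReal_injective.injOn).subset this

/-- An operator with finite-dimensional range has finite spectrum. -/
lemma finite_spectrum_of_range_le (V : Submodule ℂ H) [FiniteDimensional ℂ V]
    (hV : ∀ x, T x ∈ V) : (spectrum ℂ T).Finite := by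
  set f : Module.End ℂ V := ((T : H →ₗ[ℂ] H).codRestrict V hV).comp V.subtype with hf
  set p := minpoly ℂ f with hp
  have hp0 : p ≠ 0 := minpoly.ne_zero (Algebra.IsIntegral.isIntegral f)
  have key : ∀ (q : Polynomial ℂ) (v : V),
      (Polynomial.aeval T q) (v : H) = ((Polynomial.aeval f q) v : V) := by
    intro q
    induction q using Polynomial.induction_on' with
    | add p q hp hq => intro v; simp [hp, hq]
    | monomial n a =>
      intro v
      simp only [Polynomial.aeval_monomial]
      have : ∀ v : V, (T ^ n) (v : H) = ((f ^ n) v : V) := by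
        induction n with
        | zero => intro v; simp
        | succ n ih =>
          intro v
          have h1 : (T ^ (n + 1)) (v : H) = (T ^ n) (T v) := by rw [pow_succ]; rfl
          have h2 : (f ^ (n + 1)) v = (f ^ n) (f v) := by rw [pow_succ]; rfl
          rw [h1, h2, ← ih]; rfl
      have h3 := this v
      change a • (T ^ n) (v : H) = ((a • (f ^ n) v : V) : H)
      rw [h3]; rfl
  have hzero : Polynomial.aeval T (p * Polynomial.X) = 0 := by
    ext x
    rw [map_mul, Polynomial.aeval_X]
    change (Polynomial.aeval T p) (T x) = 0
    have := key p ⟨T x, hV x⟩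
    rw [minpoly.aeval] at this
    exact this
  have hq0 : p * Polynomial.X ≠ 0 := mul_ne_zero hp0 Polynomial.X_ne_zero
  refine ((p * Polynomial.X).roots.toFinset.finite_toSet).subset fun z hz => ?_
  have h1 := spectrum.subset_polynomial_aeval T (p * Polynomial.X) ⟨z, hz, rfl⟩
  simp only [hzero] at h1
  have h2 : (p * Polynomial.X).eval z = 0 := by
    by_contra hne
    apply h1
    rw [spectrum.mem_resolventSet_iff, sub_zero]
    exact (IsUnit.mk0 _ hne).map (algebraMap ℂ (H →L[ℂ] H))
  simpa [hp0] using h2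

variable [CompleteSpace H]

/-- The spectral projection of a self-adjoint operator `T` for the set `s`, as the continuous
functional calculus of the indicator function of `s`. It is meaningful if `Separated T s`, which
makes the indicator function continuous on the spectrum. -/
def specProj (T : H →L[ℂ] H) (s : Set ℝ) : H →L[ℂ] H := cfc (s.indicator (1 : ℝ → ℝ)) T

lemma specProj_isSelfAdjoint (T : H →L[ℂ] H) (s : Set ℝ) : IsSelfAdjoint (specProj T s) :=
  cfc_predicate _ _

lemma specProj_mul_self (h : Separated T s) :
    specProj T s * specProj T s = specProj T s := by
  unfold specProj
  rw [← cfc_mul _ _ T h.continuousOn h.continuousOn]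
  congr 1; ext x; by_cases hx : x ∈ s <;> simp [hx]

lemma specProj_idem (h : Separated T s) (x : H) :
    specProj T s (specProj T s x) = specProj T s x :=
  congr($(specProj_mul_self h) x)

lemma specProj_inner (T : H →L[ℂ] H) (s : Set ℝ) (x y : H) :
    inner ℂ (specProj T s x) y = inner ℂ x (specProj T s y) :=
  (specProj_isSelfAdjoint T s).isSymmetric x y

lemma specProj_compl (hT : IsSelfAdjoint T) (h : Separated T s) :
    specProj T sᶜ = 1 - specProj T s := by
  unfold specProj
  rw [← cfc_const_one ℝ T, ← cfc_sub _ _ T continuousOn_const h.continuousOn]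
  congr 1; ext x; by_cases hx : x ∈ s <;> simp [hx]

lemma specProj_compl_apply (hT : IsSelfAdjoint T) (h : Separated T s) (x : H) :
    specProj T sᶜ x = x - specProj T s x := by
  rw [specProj_compl hT h]; rfl

lemma specProj_commute (hT : IsSelfAdjoint T) (s : Set ℝ) :
    Commute (specProj T s) T := by
  have := cfc_commute_cfc (s.indicator (1 : ℝ → ℝ)) id T
  rwa [cfc_id ℝ T hT] at this

lemma specProj_comm_apply (hT : IsSelfAdjoint T) (s : Set ℝ) (x : H) :
    specProj T s (T x) = T (specProj T s x) :=
  congr($(specProj_commute hT s) x)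

lemma norm_specProj_apply_le (T : H →L[ℂ] H) (s : Set ℝ) (x : H) :
    ‖specProj T s x‖ ≤ ‖x‖ := by
  have h : ‖specProj T s‖ ≤ 1 := by
    refine norm_cfc_le zero_le_one fun x _ => ?_
    by_cases hx : x ∈ s <;> simp [hx]
  simpa using (specProj T s).le_of_opNorm_le h x

/-- The part of `T - c` over `s` is inverted by a bounded function of `T` when the spectrum of `T`
in `s` keeps a distance `d` from `c`. -/
lemma exists_inverse_on (hT : IsSelfAdjoint T) (h : Separated T s) {c d : ℝ} (hd : 0 < d)
    (hs : ∀ x ∈ spectrum ℝ T ∩ s, d ≤ |x - c|) :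
    ∃ G : H →L[ℂ] H, (T - (c : ℂ) • 1) * G = specProj T s ∧ G * (T - (c : ℂ) • 1) = specProj T s ∧
      ∀ x, d * ‖G x‖ ≤ ‖x‖ := by
  set g : ℝ → ℝ := fun x => s.indicator (1 : ℝ → ℝ) x * (x - c)⁻¹ with hg
  have hgc : ContinuousOn g (spectrum ℝ T) := by
    rw [← inter_union_sdiff (spectrum ℝ T) s]
    refine ContinuousOn.union_of_isClosed ?_ ?_ h.1 h.2
    · have : ContinuousOn (fun x : ℝ => (x - c)⁻¹) (spectrum ℝ T ∩ s) := by
        refine ContinuousOn.inv₀ (by fun_prop) fun x hx h0 => ?_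
        have := hs x hx
        rw [h0] at this; simp at this; linarith
      exact this.congr fun x hx => by simp [hg, hx.2]
    · exact (continuousOn_const (c := (0 : ℝ))).congr fun x hx => by simp [hg, hx.2]
  have hTc : T - (c : ℂ) • 1 = cfc (fun x : ℝ => x - c) T := by
    rw [cfc_sub _ _ T, cfc_id' ℝ T, cfc_const c T]
    congr 1
  have hmul : ∀ x ∈ spectrum ℝ T, (x - c) * g x = s.indicator (1 : ℝ → ℝ) x := by
    intro x hx
    by_cases hxs : x ∈ s
    · have : x - c ≠ 0 := by
        intro h0
        have := hs x ⟨hx, hxs⟩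
        rw [h0] at this; simp at this; linarith
      simp [hg, hxs, this]
    · simp [hg, hxs]
  refine ⟨cfc g T, ?_, ?_, fun x => ?_⟩
  · rw [hTc, ← cfc_mul _ _ T (by fun_prop) hgc]
    exact cfc_congr hmul
  · rw [hTc, ← cfc_mul _ _ T hgc (by fun_prop)]
    exact cfc_congr fun x hx => by rw [mul_comm]; exact hmul x hx
  · have hn : ‖cfc g T‖ ≤ d⁻¹ := by
      refine norm_cfc_le (by positivity) fun x hx => ?_
      by_cases hxs : x ∈ s
      · have := hs x ⟨hx, hxs⟩
        simp only [hg, indicator_of_mem hxs, Pi.one_apply, one_mul, norm_inv, Real.norm_eq_abs]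
        exact inv_anti₀ hd this
      · simp [hg, hxs, hd.le]
    have := (cfc g T).le_of_opNorm_le hn x
    rw [inv_mul_eq_div, le_div_iff₀ hd] at this
    linarith

/-- The spectral gap estimate. -/
lemma mul_norm_specProj_le (hT : IsSelfAdjoint T) (h : Separated T s) {c d : ℝ} (hd : 0 < d)
    (hs : ∀ x ∈ spectrum ℝ T ∩ s, d ≤ |x - c|) (y : H) :
    d * ‖specProj T s y‖ ≤ ‖T y - (c : ℂ) • y‖ := by
  obtain ⟨G, -, h2, h3⟩ := exists_inverse_on hT h hd hs
  rw [← h2]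
  exact h3 _

/-- On the range of the spectral projection of `s`, the operator `T - c` is surjective and bounded
below by the distance from `c` to the spectrum in `s`. -/
lemma exists_preimage (hT : IsSelfAdjoint T) (h : Separated T s) {c d : ℝ} (hd : 0 < d)
    (hs : ∀ x ∈ spectrum ℝ T ∩ s, d ≤ |x - c|) {u : H} (hu : specProj T s u = u) :
    ∃ w, specProj T s w = w ∧ T w - (c : ℂ) • w = u ∧ d * ‖w‖ ≤ ‖u‖ := by
  obtain ⟨G, h1, h2, h3⟩ := exists_inverse_on hT h hd hs
  have h4 : T (G u) - (c : ℂ) • G u = u := by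
    have := congr($h1 u)
    rw [hu] at this
    exact this
  refine ⟨G u, ?_, h4, h3 u⟩
  have : G (T (G u) - (c : ℂ) • G u) = specProj T s (G u) := congr($h2 (G u))
  rw [h4] at this
  exact this.symm

lemma norm_sub_smul_specProj_le (hT : IsSelfAdjoint T) (h : Separated T s) {c r : ℝ} (hr : 0 ≤ r)
    (hs : ∀ x ∈ spectrum ℝ T ∩ s, |x - c| ≤ r) {y : H} (hy : specProj T s y = y) :
    ‖T y - (c : ℂ) • y‖ ≤ r * ‖y‖ := by
  have hTc : T - (c : ℂ) • 1 = cfc (fun x : ℝ => x - c) T := by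
    rw [cfc_sub _ _ T, cfc_id' ℝ T, cfc_const c T]
    congr 1
  have hn : ‖(T - (c : ℂ) • 1) * specProj T s‖ ≤ r := by
    rw [hTc, specProj, ← cfc_mul _ _ T (by fun_prop) h.continuousOn]
    refine norm_cfc_le hr fun x hx => ?_
    by_cases hxs : x ∈ s
    · simpa [hxs] using hs x ⟨hx, hxs⟩
    · simpa [hxs] using hr
  have := ((T - (c : ℂ) • 1) * specProj T s).le_of_opNorm_le hn y
  have h2 : ((T - (c : ℂ) • 1) * specProj T s) y = T y - (c : ℂ) • y := by
    change (T - (c : ℂ) • 1) (specProj T s y) = _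
    rw [hy]; rfl
  rwa [h2] at this

lemma specProj_singleton_eigen (hT : IsSelfAdjoint T) {τ : ℝ} (h : Separated T {τ}) {y : H}
    (hy : specProj T {τ} y = y) : T y = (τ : ℂ) • y := by
  have := norm_sub_smul_specProj_le hT h (c := τ) le_rfl (by rintro x ⟨-, rfl⟩; simp) hy
  rw [zero_mul, norm_le_zero_iff, sub_eq_zero] at this
  exact this

/-- An isolated point of the spectrum is an eigenvalue. -/
lemma exists_eigenvector (hT : IsSelfAdjoint T) {τ : ℝ} (h : Separated T {τ})
    (hτ : τ ∈ spectrum ℝ T) : ∃ x, x ≠ 0 ∧ T x = (τ : ℂ) • x := by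
  have hne : specProj T {τ} ≠ 0 := by
    intro h0
    rw [specProj, ← cfc_zero ℝ T] at h0
    have := eqOn_of_cfc_eq_cfc h0 h.continuousOn continuousOn_const hT hτ
    simp at this
  obtain ⟨x, hx⟩ : ∃ x, specProj T {τ} x ≠ 0 := by
    by_contra! hc
    exact hne (ContinuousLinearMap.ext hc)
  exact ⟨_, hx, specProj_singleton_eigen hT h (specProj_idem h x)⟩

lemma specProj_eigen (hT : IsSelfAdjoint T) (h : Separated T s) {τ : ℝ} (hτ : τ ∈ s) {x : H}
    (hx : T x = (τ : ℂ) • x) : specProj T s x = x := by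
  by_cases hx0 : x = 0
  · simp [hx0]
  have hτσ := mem_spectrum_of_eigen hx0 hx
  obtain ⟨d, hd, hdist⟩ : ∃ d > 0, ∀ y ∈ spectrum ℝ T \ s, d ≤ |y - τ| := by
    have : (spectrum ℝ T \ s)ᶜ ∈ 𝓝 τ := h.2.isOpen_compl.mem_nhds fun h' => h'.2 hτ
    obtain ⟨d, hd, hball⟩ := Metric.mem_nhds_iff.1 this
    refine ⟨d, hd, fun y hy => ?_⟩
    by_contra! hlt
    exact hball (by simpa [Real.dist_eq] using hlt) hy
  have := mul_norm_specProj_le hT h.compl hd (c := τ) (by simpa [← sdiff_eq] using hdist) x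
  rw [hx, sub_self, norm_zero, specProj_compl_apply hT h] at this
  have h0 : ‖x - specProj T s x‖ ≤ 0 := by
    by_contra! h'
    nlinarith
  rw [norm_le_zero_iff, sub_eq_zero] at h0
  exact h0.symm

/-- The range of the spectral projection for a set which meets the spectrum in finitely many
isolated points is spanned by eigenvectors. -/
lemma specProj_eq_self_iff (hT : IsSelfAdjoint T) (h : Separated T s)
    (hfin : (spectrum ℝ T ∩ s).Finite) {x : H} : specProj T s x = x ↔ x ∈ eigSup T s := by
  constructor
  · intro hx
    have hsum : specProj T s = ∑ τ ∈ hfin.toFinset, specProj T {τ} := by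
      unfold specProj
      have hc : ∀ τ ∈ hfin.toFinset,
          ContinuousOn (({τ} : Set ℝ).indicator (1 : ℝ → ℝ)) (spectrum ℝ T) := fun τ hτ =>
        (h.mono hfin (singleton_subset_iff.2 (hfin.mem_toFinset.1 hτ).2)).continuousOn
      rw [← cfc_sum (fun τ : ℝ => ({τ} : Set ℝ).indicator (1 : ℝ → ℝ)) T hfin.toFinset hc]
      refine cfc_congr fun y hy => ?_
      simp only [Finset.sum_apply]
      by_cases hys : y ∈ s
      · rw [Finset.sum_eq_single y]
        · simp [hys]
        · intro b _ hb; simp [Ne.symm hb]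
        · intro hn; exact absurd (hfin.mem_toFinset.2 ⟨hy, hys⟩) hn
      · rw [Finset.sum_eq_zero]
        · simp [hys]
        · intro b hb
          have : y ≠ b := fun e => hys (e ▸ (hfin.mem_toFinset.1 hb).2)
          simp [this]
    rw [← hx, hsum, _root_.sum_apply]
    refine Submodule.sum_mem _ fun τ hτ => ?_
    have hτs := (hfin.mem_toFinset.1 hτ).2
    have hsep := h.mono hfin (singleton_subset_iff.2 hτs)
    exact mem_eigSup_of_eigen hτs (specProj_singleton_eigen hT hsep (specProj_idem hsep x))
  · intro hx
    have : eigSup T s ≤ LinearMap.ker ((specProj T s - 1 : H →L[ℂ] H) : H →ₗ[ℂ] H) := by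
      refine iSup₂_le fun τ hτ y hy => ?_
      have := specProj_eigen hT h hτ (Module.End.mem_eigenspace_iff.1 hy)
      simp [this]
    have := this hx
    simpa [sub_eq_zero] using this

end SpecProj

/-! ### Strong convergence -/

section Strong

lemma norm_sub_starProjection_le (K : Submodule ℂ H) [K.HasOrthogonalProjection] (x : H) {w : H}
    (hw : w ∈ K) : ‖x - K.starProjection x‖ ≤ ‖x - w‖ := by
  rw [Submodule.starProjection_minimal]
  exact ciInf_le ⟨0, by rintro _ ⟨y, rfl⟩; positivity⟩ (⟨w, hw⟩ : K)

/-- Strong convergence to zero is uniform on finite-dimensional subspaces. -/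
lemma eventually_norm_le_of_finiteDimensional (V : Submodule ℂ H) [FiniteDimensional ℂ V]
    {B : ℕ → H →L[ℂ] H} (hB : ∀ x ∈ V, Tendsto (fun n => B n x) atTop (𝓝 0)) {ε : ℝ}
    (hε : 0 < ε) : ∀ᶠ n in atTop, ∀ x ∈ V, ‖B n x‖ ≤ ε * ‖x‖ := by
  set e := stdOrthonormalBasis ℂ V with he
  have h1 : Tendsto (fun n => ∑ i, ‖B n (e i)‖) atTop (𝓝 0) := by
    have : Tendsto (fun n => ∑ i, ‖B n (e i)‖) atTop (𝓝 (∑ _i, ‖(0 : H)‖)) :=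
      tendsto_finsetSum _ fun i _ => (hB _ (e i).2).norm
    simpa using this
  filter_upwards [h1.eventually (gt_mem_nhds hε)] with n hn x hx
  have hx' : x = ∑ i, inner ℂ (e i) (⟨x, hx⟩ : V) • (e i : H) := by
    have := congr_arg (Subtype.val : V → H) (e.sum_repr' ⟨x, hx⟩)
    simpa using this.symm
  calc ‖B n x‖ = ‖∑ i, inner ℂ (e i) (⟨x, hx⟩ : V) • B n (e i : H)‖ := by
        conv_lhs => rw [hx']
        simp [map_sum]
    _ ≤ ∑ i, ‖x‖ * ‖B n (e i)‖ := by
        refine norm_sum_le_of_le _ fun i _ => ?_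
        rw [norm_smul]
        gcongr
        have := norm_inner_le_norm (𝕜 := ℂ) (e i) (⟨x, hx⟩ : V)
        simpa [e.norm_eq_one] using this
    _ = (∑ i, ‖B n (e i)‖) * ‖x‖ := by rw [← Finset.mul_sum, mul_comm]
    _ ≤ ε * ‖x‖ := by gcongr

variable [CompleteSpace H] {T : H →L[ℂ] H} {Tn : ℕ → H →L[ℂ] H} {s : Set ℝ} {α β : ℝ}

lemma starProjection_eigSup_apply (hT : IsSelfAdjoint T) (h : Separated T s)
    (hfin : (spectrum ℝ T ∩ s).Finite) [(eigSup T s).HasOrthogonalProjection] (x : H) :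
    (eigSup T s).starProjection x = specProj T s x := by
  refine Submodule.eq_starProjection_of_mem_of_inner_eq_zero
    ((specProj_eq_self_iff hT h hfin).1 (specProj_idem h x)) fun w hw => ?_
  rw [← (specProj_eq_self_iff hT h hfin).2 hw, ← specProj_inner, map_sub, specProj_idem h, sub_self,
    inner_zero_left]

lemma separated_Icc (hα : α ∉ spectrum ℝ T) (hβ : β ∉ spectrum ℝ T) :
    Separated T (Icc α β) := by
  refine ⟨(spectrum.isClosed T).inter isClosed_Icc, ?_⟩
  have : spectrum ℝ T \ Icc α β = spectrum ℝ T \ Ioo α β := by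
    ext x
    refine and_congr_right fun hx => not_congr ⟨fun h => ⟨?_, ?_⟩, fun h => ⟨h.1.le, h.2.le⟩⟩
    · exact lt_of_le_of_ne h.1 fun e => hα (e ▸ hx)
    · exact lt_of_le_of_ne h.2 fun e => hβ (e ▸ hx)
  rw [this]
  exact (spectrum.isClosed T).sdiff isOpen_Ioo

/-- Points of the resolvent set at the ends of an interval leave room around that interval. -/
lemma exists_margin (hα : α ∉ spectrum ℝ T) (hβ : β ∉ spectrum ℝ T) :
    ∃ ε > 0, ∀ x ∈ spectrum ℝ T, x ∉ Icc α β → x ≤ α - ε ∨ β + ε ≤ x := by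
  obtain ⟨ε₁, h1, h1'⟩ := Metric.mem_nhds_iff.1 ((spectrum.isClosed T).isOpen_compl.mem_nhds hα)
  obtain ⟨ε₂, h2, h2'⟩ := Metric.mem_nhds_iff.1 ((spectrum.isClosed T).isOpen_compl.mem_nhds hβ)
  refine ⟨min ε₁ ε₂, by positivity, fun x hx hxJ => ?_⟩
  by_contra! hc
  have m1 := min_le_left ε₁ ε₂
  have m2 := min_le_right ε₁ ε₂
  by_cases hxα : x < α
  · exact h1' (by rw [Metric.mem_ball, Real.dist_eq, abs_lt]; constructor <;> linarith) hx
  · have hxβ : β < x := by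
      by_contra hxβ
      exact hxJ ⟨not_lt.1 hxα, not_lt.1 hxβ⟩
    exact h2' (by rw [Metric.mem_ball, Real.dist_eq, abs_lt]; constructor <;> linarith) hx

/-- If `Tₙ → T` strongly, then the spectral projections for an interval whose end points are not in
the spectrum of `T` converge to zero on the vectors without spectral part in that interval. Such a
vector is `(T - c) w`, where `c` is the midpoint of the interval, and the factor `T - c` is larger
outside the interval than `Tₙ - c` is inside it; this can be iterated. -/
lemma specProj_tendsto_zero (hT : IsSelfAdjoint T) (hTn : ∀ n, IsSelfAdjoint (Tn n))
    (hconv : ∀ x, Tendsto (fun n => Tn n x) atTop (𝓝 (T x))) (hαβ : α < β)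
    (hα : α ∉ spectrum ℝ T) (hβ : β ∉ spectrum ℝ T) (hsep : ∀ n, Separated (Tn n) (Icc α β))
    {u : H} (hu : specProj T (Icc α β) u = 0) :
    Tendsto (fun n => specProj (Tn n) (Icc α β) u) atTop (𝓝 0) := by
  have hs := separated_Icc hα hβ
  obtain ⟨δ, hδ, hmargin⟩ := exists_margin hα hβ
  set c := (α + β) / 2 with hc
  set r := (β - α) / 2 with hr
  have hr0 : 0 < r := by rw [hr]; linarith
  set q := r / (r + δ) with hq
  have hq0 : 0 ≤ q := by positivity
  have hq1 : q < 1 := by rw [hq, div_lt_one (by positivity)]; linarith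
  have key : ∀ j : ℕ, ∀ u, specProj T (Icc α β) u = 0 → ∀ ε > 0, ∀ᶠ n in atTop,
      ‖specProj (Tn n) (Icc α β) u‖ ≤ q ^ j * ‖u‖ + ε := by
    intro j
    induction j with
    | zero =>
      intro u _ ε hε
      filter_upwards with n
      have := norm_specProj_apply_le (Tn n) (Icc α β) u
      simp only [pow_zero, one_mul]; linarith
    | succ j ih =>
      intro u hu ε hε
      obtain ⟨w, hw, hwu, hwn⟩ := exists_preimage hT hs.compl (c := c) (d := r + δ) (by positivity)
        (by
          rintro x ⟨hx, hxJ⟩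
          rcases hmargin x hx hxJ with h | h
          · rw [abs_of_nonpos (by rw [hc]; linarith)]; rw [hc, hr]; linarith
          · rw [abs_of_nonneg (by rw [hc]; linarith)]; rw [hc, hr]; linarith)
        (u := u) (by rw [specProj_compl_apply hT hs, hu, sub_zero])
      have hw0 : specProj T (Icc α β) w = 0 := by
        rw [specProj_compl_apply hT hs] at hw
        simpa using hw
      have hw' : r * ‖w‖ ≤ q * ‖u‖ := by
        rw [hq, div_mul_eq_mul_div r, le_div_iff₀ (by positivity)]
        nlinarith
      have h1 := ih w hw0 (ε / (2 * r)) (by positivity)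
      have h2 : ∀ᶠ n in atTop, ‖Tn n w - T w‖ < ε / 2 := by
        have := (tendsto_iff_norm_sub_tendsto_zero.1 (hconv w))
        exact this.eventually (gt_mem_nhds (by positivity))
      filter_upwards [h1, h2] with n h1 h2
      set F := specProj (Tn n) (Icc α β) with hF
      have e1 : F u = (Tn n (F w) - (c : ℂ) • F w) - F (Tn n w - T w) := by
        rw [← hwu, ← specProj_comm_apply (hTn n)]
        simp only [map_sub, map_smul]
        abel
      have e2 : ‖Tn n (F w) - (c : ℂ) • F w‖ ≤ r * ‖F w‖ := by
        refine norm_sub_smul_specProj_le (hTn n) (hsep n) hr0.le ?_ (specProj_idem (hsep n) w)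
        rintro x ⟨-, hx1, hx2⟩
        rw [abs_le, hc, hr]; constructor <;> linarith
      have e3 := norm_specProj_apply_le (Tn n) (Icc α β) (Tn n w - T w)
      have e4 : r * ‖F w‖ ≤ r * (q ^ j * ‖w‖ + ε / (2 * r)) := by gcongr
      have e5 : r * (q ^ j * ‖w‖ + ε / (2 * r)) = q ^ j * (r * ‖w‖) + ε / 2 := by
        field_simp
      have e6 : q ^ j * (r * ‖w‖) ≤ q ^ j * (q * ‖u‖) := by gcongr
      calc ‖F u‖ ≤ ‖Tn n (F w) - (c : ℂ) • F w‖ + ‖F (Tn n w - T w)‖ := by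
            rw [e1]; exact norm_sub_le _ _
        _ ≤ q ^ (j + 1) * ‖u‖ + ε := by rw [pow_succ, mul_assoc]; linarith
  rw [tendsto_zero_iff_norm_tendsto_zero, Metric.tendsto_nhds]
  intro ε hε
  have : Tendsto (fun j : ℕ => q ^ j * ‖u‖) atTop (𝓝 (0 * ‖u‖)) :=
    (tendsto_pow_atTop_nhds_zero_of_lt_one hq0 hq1).mul_const _
  rw [zero_mul] at this
  obtain ⟨j, hj⟩ := (this.eventually (gt_mem_nhds (half_pos hε))).exists
  filter_upwards [key j u hu (ε / 3) (by positivity)] with n hn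
  rw [Real.dist_eq, sub_zero, abs_of_nonneg (norm_nonneg _)]
  linarith

/-- If `Tₙ → T` strongly, then the spectral projections for an interval whose end points are not in
the spectrum of `T` converge strongly. -/
theorem specProj_tendsto (hT : IsSelfAdjoint T) (hTn : ∀ n, IsSelfAdjoint (Tn n))
    (hconv : ∀ x, Tendsto (fun n => Tn n x) atTop (𝓝 (T x))) (hαβ : α < β)
    (hα : α ∉ spectrum ℝ T) (hβ : β ∉ spectrum ℝ T) (hsep : ∀ n, Separated (Tn n) (Icc α β))
    (hfin : (spectrum ℝ T ∩ Icc α β).Finite) (x : H) :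
    Tendsto (fun n => specProj (Tn n) (Icc α β) x) atTop (𝓝 (specProj T (Icc α β) x)) := by
  have hs := separated_Icc hα hβ
  let N : Submodule ℂ H :=
    { carrier := {x | Tendsto (fun n => specProj (Tn n) (Icc α β) x) atTop (𝓝 x)}
      add_mem' := fun {x y} hx hy => by
        simp only [mem_ofPred_eq, map_add] at hx hy ⊢
        exact hx.add hy
      zero_mem' := by simp
      smul_mem' := fun c x hx => by
        simp only [mem_ofPred_eq, map_smul] at hx ⊢
        exact hx.const_smul c }
  have hN : eigSup T (Icc α β) ≤ N := by
    refine iSup₂_le fun τ hτ y hy => ?_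
    change Tendsto (fun n => specProj (Tn n) (Icc α β) y) atTop (𝓝 y)
    have hy' : T y = (τ : ℂ) • y := Module.End.mem_eigenspace_iff.1 hy
    by_cases hy0 : y = 0
    · simp [hy0]
    have hτσ := mem_spectrum_of_eigen hy0 hy'
    have h1 : α < τ := lt_of_le_of_ne hτ.1 fun e => hα (e ▸ hτσ)
    have h2 : τ < β := lt_of_le_of_ne hτ.2 fun e => hβ (e ▸ hτσ)
    set d := min (τ - α) (β - τ) with hd
    have hd0 : 0 < d := lt_min (by linarith) (by linarith)
    have hlim : Tendsto (fun n => d⁻¹ * ‖Tn n y - T y‖) atTop (𝓝 0) := by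
      simpa using (tendsto_iff_norm_sub_tendsto_zero.1 (hconv y)).const_mul d⁻¹
    rw [tendsto_iff_norm_sub_tendsto_zero]
    refine squeeze_zero (fun _ => norm_nonneg _) (fun n => ?_) hlim
    have := mul_norm_specProj_le (hTn n) (hsep n).compl hd0 (c := τ) (by
      rintro z ⟨-, hz⟩
      have m1 := min_le_left (τ - α) (β - τ)
      have m2 := min_le_right (τ - α) (β - τ)
      by_cases hzα : z < α
      · rw [abs_of_nonpos (by linarith)]; linarith
      · have hzβ : β < z := by
          by_contra hzβ
          exact hz ⟨not_lt.1 hzα, not_lt.1 hzβ⟩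
        rw [abs_of_nonneg (by linarith)]; linarith) y
    rw [specProj_compl_apply (hTn n) (hsep n), ← hy'] at this
    rw [norm_sub_rev, inv_mul_eq_div, le_div_iff₀ hd0]
    linarith
  have h1 : Tendsto (fun n => specProj (Tn n) (Icc α β) (specProj T (Icc α β) x)) atTop
      (𝓝 (specProj T (Icc α β) x)) := hN ((specProj_eq_self_iff hT hs hfin).1 (specProj_idem hs x))
  have h2 := specProj_tendsto_zero hT hTn hconv hαβ hα hβ hsep
    (u := x - specProj T (Icc α β) x) (by rw [map_sub, specProj_idem hs, sub_self])
  simpa using h1.add h2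

end Strong

/-! ### Spectral projections of the compressed operators and their images -/

section Image

lemma compression_tendsto {T : H →L[ℂ] H} {K : ℕ → Submodule ℂ H}
    [∀ n, (K n).HasOrthogonalProjection]
    (hK : ∀ x, Tendsto (fun n => (K n).starProjection x) atTop (𝓝 x)) (x : H) :
    Tendsto (fun n => ((K n).starProjection * T * (K n).starProjection) x) atTop (𝓝 (T x)) := by
  have h1 : Tendsto (fun n => T ((K n).starProjection x) - T x) atTop (𝓝 0) := by
    simpa using ((T.continuous.tendsto x).comp (hK x)).sub_const (T x)
  have h2 : Tendsto (fun n => (K n).starProjection (T ((K n).starProjection x) - T x)) atTop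
      (𝓝 0) :=
    squeeze_zero_norm (fun n => Submodule.norm_starProjection_apply_le _ _)
      (tendsto_zero_iff_norm_tendsto_zero.1 h1)
  have h3 := h2.add (hK (T x))
  refine (h3.congr fun n => ?_).trans (by simp)
  rw [map_sub, sub_add_cancel]; rfl

variable [CompleteSpace H]

lemma compression_isSelfAdjoint {T : H →L[ℂ] H} (hT : IsSelfAdjoint T) (K : Submodule ℂ H)
    [K.HasOrthogonalProjection] :
    IsSelfAdjoint (K.starProjection * T * K.starProjection) := by
  have hK : IsSelfAdjoint K.starProjection := isSelfAdjoint_starProjection K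
  simpa [hK.star_eq] using hT.conjugate K.starProjection

/-- On the range of a spectral projection for numbers `≥ α`, the quadratic form is `≥ α`. -/
lemma le_inner_of_specProj {T : H →L[ℂ] H} (hT : IsSelfAdjoint T) {α β : ℝ} (hαβ : α ≤ β)
    (h : Separated T (Icc α β)) {y : H} (hy : specProj T (Icc α β) y = y) :
    α * ‖y‖ ^ 2 ≤ (inner ℂ (T y) y).re := by
  set c := (α + β) / 2 with hc
  set r := (β - α) / 2 with hr
  have h1 : ‖T y - (c : ℂ) • y‖ ≤ r * ‖y‖ := by
    refine norm_sub_smul_specProj_le hT h (by rw [hr]; linarith) ?_ hy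
    rintro x ⟨-, hx1, hx2⟩
    rw [abs_le, hc, hr]; constructor <;> linarith
  have h2 : (inner ℂ (T y) y).re = (inner ℂ (T y - (c : ℂ) • y) y).re + c * ‖y‖ ^ 2 := by
    rw [inner_sub_left, inner_smul_left, inner_self_eq_norm_sq_to_K]
    simp [← Complex.ofReal_pow]
  have h3 : |(inner ℂ (T y - (c : ℂ) • y) y).re| ≤ r * ‖y‖ * ‖y‖ :=
    (Complex.abs_re_le_norm _).trans ((norm_inner_le_norm _ _).trans (by gcongr))
  have h4 := (abs_le.1 h3).1
  rw [h2]
  have : α = c - r := by rw [hc, hr]; ring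
  rw [this]; nlinarith

/-- If `S` is bounded below on `W`, the orthogonal projection onto `S W` is controlled by the
orthogonal projection `F` onto `W`. -/
lemma norm_starProjection_map_le {S F : H →L[ℂ] H} (hS : IsSelfAdjoint S) (hF : IsSelfAdjoint F)
    {W : Submodule ℂ H} (hFW : ∀ y ∈ W, F y = y) {α : ℝ} (hα : 0 < α)
    (hW : ∀ y ∈ W, α * ‖y‖ ^ 2 ≤ ‖S y‖ ^ 2)
    [(W.map (S : H →ₗ[ℂ] H)).HasOrthogonalProjection] (u : H) :
    α * ‖(W.map (S : H →ₗ[ℂ] H)).starProjection u‖ ^ 2 ≤ ‖F (S u)‖ ^ 2 := by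
  set G := W.map (S : H →ₗ[ℂ] H) with hG
  obtain ⟨y, hy, hSy⟩ := Submodule.starProjection_apply_mem G u
  have hSy' : S y = G.starProjection u := hSy
  have h1 : ‖G.starProjection u‖ ^ 2 ≤ ‖y‖ * ‖F (S u)‖ := by
    have e : inner ℂ (G.starProjection u) (G.starProjection u) = inner ℂ y (F (S u)) := by
      have a1 : G.starProjection (G.starProjection u) = G.starProjection u := by
        rw [Submodule.starProjection_eq_self_iff]; exact Submodule.starProjection_apply_mem G u
      have a2 : inner ℂ (S y) u = inner ℂ y (S u) := hS.isSymmetric y u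
      have a3 : inner ℂ (F y) (S u) = inner ℂ y (F (S u)) := hF.isSymmetric y (S u)
      rw [← Submodule.inner_starProjection_left_eq_right, a1, ← hSy', a2, ← a3, hFW y hy]
    have := norm_inner_le_norm (𝕜 := ℂ) y (F (S u))
    rw [← e, inner_self_eq_norm_sq_to_K] at this
    simpa using this
  have h2 := hW y hy
  rw [hSy'] at h2
  set g := ‖G.starProjection u‖
  by_cases hg : g = 0
  · rw [hg]; simp
  have hg0 : 0 < g := lt_of_le_of_ne (norm_nonneg _) (Ne.symm hg)
  have h3 : (g ^ 2) ^ 2 ≤ (‖y‖ * ‖F (S u)‖) ^ 2 := by gcongr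
  have h4 : α * (g ^ 2) ^ 2 ≤ g ^ 2 * ‖F (S u)‖ ^ 2 := by
    calc α * (g ^ 2) ^ 2 ≤ α * (‖y‖ * ‖F (S u)‖) ^ 2 := by gcongr
      _ = (α * ‖y‖ ^ 2) * ‖F (S u)‖ ^ 2 := by ring
      _ ≤ g ^ 2 * ‖F (S u)‖ ^ 2 := by gcongr
  have h5 : g ^ 2 * (α * g ^ 2) ≤ g ^ 2 * ‖F (S u)‖ ^ 2 := by linarith
  exact le_of_mul_le_mul_left h5 (by positivity)

end Image

section ImageConv

variable [CompleteSpace H]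

/-- If the orthogonal projections onto `Wₙ` converge strongly to the one onto an `S`-invariant
subspace `E`, and if `S` is bounded below on the `Wₙ` uniformly, then the orthogonal projections
onto `S Wₙ` converge strongly to the one onto `E`, too. -/
theorem starProjection_map_tendsto {S : H →L[ℂ] H} (hS : IsSelfAdjoint S)
    {E : Submodule ℂ H} {W : ℕ → Submodule ℂ H} [E.HasOrthogonalProjection]
    [∀ n, (W n).HasOrthogonalProjection]
    [∀ n, ((W n).map (S : H →ₗ[ℂ] H)).HasOrthogonalProjection]
    (hconv : ∀ x, Tendsto (fun n => (W n).starProjection x) atTop (𝓝 (E.starProjection x)))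
    (hSE : ∀ u ∈ E, S u ∈ E) (hES : ∀ u ∈ E, ∃ x ∈ E, S x = u) {α : ℝ} (hα : 0 < α)
    (hW : ∀ n, ∀ y ∈ W n, α * ‖y‖ ^ 2 ≤ ‖S y‖ ^ 2) (u : H) :
    Tendsto (fun n => ((W n).map (S : H →ₗ[ℂ] H)).starProjection u) atTop
      (𝓝 (E.starProjection u)) := by
  set G : ℕ → Submodule ℂ H := fun n => (W n).map (S : H →ₗ[ℂ] H) with hG
  have hE : ∀ v ∈ E, Tendsto (fun n => (G n).starProjection v) atTop (𝓝 v) := by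
    intro v hv
    obtain ⟨x, hx, rfl⟩ := hES v hv
    have h1 : Tendsto (fun n => ‖S x - S ((W n).starProjection x)‖) atTop (𝓝 0) := by
      have := hconv x
      rw [Submodule.starProjection_eq_self_iff.2 hx] at this
      have h2 := ((S.continuous.tendsto x).comp this)
      have h3 := (tendsto_const_nhds (x := S x)).sub h2
      simpa using h3.norm
    rw [tendsto_iff_norm_sub_tendsto_zero]
    refine squeeze_zero (fun _ => norm_nonneg _) (fun n => ?_) h1
    rw [norm_sub_rev]
    exact norm_sub_starProjection_le _ _
      (Submodule.mem_map_of_mem (Submodule.starProjection_apply_mem _ _))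
  have hE' : ∀ v ∈ Eᗮ, Tendsto (fun n => (G n).starProjection v) atTop (𝓝 0) := by
    intro v hv
    have hSv : S v ∈ Eᗮ := by
      intro w hw
      have := hS.isSymmetric w v
      exact this.symm.trans (hv _ (hSE w hw))
    have h1 : Tendsto (fun n => ‖(W n).starProjection (S v)‖ ^ 2) atTop (𝓝 0) := by
      have := hconv (S v)
      rw [E.starProjection_apply_eq_zero_iff.2 hSv] at this
      simpa using this.norm.pow 2
    have h2 : Tendsto (fun n => ‖(G n).starProjection v‖ ^ 2) atTop (𝓝 0) := by
      refine squeeze_zero (fun _ => by positivity) (fun n => ?_)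
        (by simpa using h1.const_mul α⁻¹)
      rw [inv_mul_eq_div, le_div_iff₀ hα, mul_comm]
      exact norm_starProjection_map_le hS (isSelfAdjoint_starProjection (W n))
        (fun y hy => Submodule.starProjection_eq_self_iff.2 hy) hα (hW n) v
    rw [tendsto_zero_iff_norm_tendsto_zero]
    simpa using h2.sqrt
  have h := (hE _ (Submodule.starProjection_apply_mem E u)).add
    (hE' _ (E.sub_starProjection_mem_orthogonal u))
  simpa [← map_add] using h

end ImageConv

/-! ### Filtering a Galerkin spectral subspace by a fixed projection -/

section Filtering

/-- Every vector `u` of `K` is within distance `ε ‖u‖` of `M`. -/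
def SubClose (K M : Submodule ℂ H) (ε : ℝ) : Prop :=
  ∀ u ∈ K, ∃ v ∈ M, ‖u - v‖ ≤ ε * ‖u‖

variable (E L : Submodule ℂ H) [E.HasOrthogonalProjection]
  [L.HasOrthogonalProjection]

/-- The compression to `E` of the orthogonal projection onto `L`. -/
def filterOp : H →L[ℂ] H := E.starProjection * L.starProjection * E.starProjection

lemma filterOp_apply (x : H) :
    filterOp E L x = E.starProjection (L.starProjection (E.starProjection x)) := rfl

lemma filterOp_isSelfAdjoint [CompleteSpace H] : IsSelfAdjoint (filterOp E L) :=
  compression_isSelfAdjoint (isSelfAdjoint_starProjection L) E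

lemma filterOp_mem (x : H) : filterOp E L x ∈ E := Submodule.starProjection_apply_mem _ _

lemma norm_filterOp_apply_le (x : H) : ‖filterOp E L x‖ ≤ ‖x‖ :=
  (Submodule.norm_starProjection_apply_le _ _).trans
    ((Submodule.norm_starProjection_apply_le _ _).trans
      (Submodule.norm_starProjection_apply_le _ _))

lemma filterOp_inner_self (x : H) :
    inner ℂ (filterOp E L x) x = ((‖L.starProjection (E.starProjection x)‖ ^ 2 : ℝ) : ℂ) := by
  rw [filterOp_apply, Submodule.inner_starProjection_left_eq_right]
  have : L.starProjection (E.starProjection x)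
      = L.starProjection (L.starProjection (E.starProjection x)) :=
    (Submodule.starProjection_eq_self_iff.2 (Submodule.starProjection_apply_mem _ _)).symm
  conv_lhs => rw [this]
  rw [Submodule.inner_starProjection_left_eq_right, inner_self_eq_norm_sq_to_K]
  simp

variable {E L}

lemma mem_of_filterOp_eigen {τ : ℝ} (hτ : τ ≠ 0) {x : H} (hx : filterOp E L x = (τ : ℂ) • x) :
    x ∈ E := by
  have : x = (τ : ℂ)⁻¹ • filterOp E L x := by
    rw [hx, smul_smul, inv_mul_cancel₀ (by exact_mod_cast hτ), one_smul]
  rw [this]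
  exact E.smul_mem _ (filterOp_mem E L x)

lemma filterOp_eigenvalue_mem {τ : ℝ} {x : H} (hx0 : x ≠ 0)
    (hx : filterOp E L x = (τ : ℂ) • x) : τ ∈ Icc (0 : ℝ) 1 := by
  have hn : 0 < ‖x‖ := norm_pos_iff.2 hx0
  constructor
  · have h := filterOp_inner_self E L x
    rw [hx, inner_smul_left, inner_self_eq_norm_sq_to_K] at h
    have h' : τ * ‖x‖ ^ 2 = ‖L.starProjection (E.starProjection x)‖ ^ 2 := by
      apply Complex.ofReal_injective
      push_cast
      simpa using h
    by_contra! hτ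
    have : 0 ≤ ‖L.starProjection (E.starProjection x)‖ ^ 2 := by positivity
    nlinarith [pow_pos hn 2]
  · have h := norm_filterOp_apply_le E L x
    rw [hx, norm_smul] at h
    have h1 : ‖(τ : ℂ)‖ ≤ 1 := by
      by_contra! h'
      nlinarith
    rw [Complex.norm_real, Real.norm_eq_abs] at h1
    exact (le_abs_self τ).trans h1

lemma eigSup_filterOp_le {s : Set ℝ} (hs : (0 : ℝ) ∉ s) : eigSup (filterOp E L) s ≤ E :=
  iSup₂_le fun _ hτ _ hy => mem_of_filterOp_eigen (fun h => hs (h ▸ hτ))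
    (Module.End.mem_eigenspace_iff.1 hy)

/-- Eigenvalues of `filterOp E L` do not exceed `1`, so the right end point of an interval of
eigenvalues may be moved to the right of `1`. -/
lemma eigSup_filterOp_Icc (g : ℝ) {r : ℝ} (hr : 1 ≤ r) :
    eigSup (filterOp E L) (Icc g 1) = eigSup (filterOp E L) (Icc g r) := by
  apply le_antisymm
  · exact iSup₂_le fun τ hτ y hy => mem_eigSup_of_eigen (s := Icc g r) ⟨hτ.1, hτ.2.trans hr⟩
      (Module.End.mem_eigenspace_iff.1 hy)
  · refine iSup₂_le fun τ hτ y hy => ?_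
    by_cases hy0 : y = 0
    · simp [hy0]
    exact mem_eigSup_of_eigen (s := Icc g 1) ⟨hτ.1, (filterOp_eigenvalue_mem hy0
      (Module.End.mem_eigenspace_iff.1 hy)).2⟩ (Module.End.mem_eigenspace_iff.1 hy)

lemma filterOp_finite_spectrum [FiniteDimensional ℂ E] : (spectrum ℝ (filterOp E L)).Finite :=
  finite_real_spectrum (finite_spectrum_of_range_le E (filterOp_mem E L))

/-- The kernel of `E P E` is orthogonal to `E` if `P` is injective on `E`. -/
lemma starProjection_eq_zero_of_filterOp (hP : ∀ u ∈ E, L.starProjection u = 0 → u = 0) {z : H}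
    (hz : filterOp E L z = 0) : E.starProjection z = 0 := by
  have h := filterOp_inner_self E L z
  rw [hz, inner_zero_left] at h
  have h0 : ‖L.starProjection (E.starProjection z)‖ ^ 2 = 0 := by exact_mod_cast h.symm
  exact hP _ (Submodule.starProjection_apply_mem _ _) (by simpa using h0)

variable [CompleteSpace H]

lemma filterOp_exists_eigenvector [FiniteDimensional ℂ E] {τ : ℝ}
    (hτ : τ ∈ spectrum ℝ (filterOp E L)) : ∃ x, x ≠ 0 ∧ filterOp E L x = (τ : ℂ) • x :=
  exists_eigenvector (filterOp_isSelfAdjoint E L)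
    (separated_of_finite filterOp_finite_spectrum _) hτ

/-- The least non-zero spectral value exists, since the operator has finite rank and hence finite
spectrum, and since it is not zero. It is positive since the operator is. -/
lemma exists_isLeast_filterOp [FiniteDimensional ℂ E] (hE : E ≠ ⊥)
    (hP : ∀ u ∈ E, L.starProjection u = 0 → u = 0) :
    ∃ γ : ℝ, 0 < γ ∧ IsLeast (spectrum ℝ (filterOp E L) \ {0}) γ := by
  have hfin : (spectrum ℝ (filterOp E L) \ {0}).Finite :=
    filterOp_finite_spectrum.subset sdiff_subset
  have hne : (spectrum ℝ (filterOp E L) \ {0}).Nonempty := by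
    by_contra hempty
    rw [not_nonempty_iff_eq_empty, sdiff_eq_empty] at hempty
    have h0 := CFC.eq_zero_of_spectrum_subset_zero (R := ℝ) (filterOp E L) hempty
      (filterOp_isSelfAdjoint E L)
    obtain ⟨u, hu, hu0⟩ := Submodule.exists_mem_ne_zero_of_ne_bot hE
    have := starProjection_eq_zero_of_filterOp hP (z := u) (by rw [h0]; rfl)
    rw [Submodule.starProjection_eq_self_iff.2 hu] at this
    exact hu0 this
  obtain ⟨γ, hγ, hmin⟩ := exists_min_image _ id hfin hne
  refine ⟨γ, ?_, hγ, fun τ hτ => hmin τ hτ⟩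
  obtain ⟨x, hx0, hx⟩ := filterOp_exists_eigenvector hγ.1
  exact lt_of_le_of_ne (filterOp_eigenvalue_mem hx0 hx).1 (Ne.symm hγ.2)

/-- `E` is the spectral subspace of `E P E` for the non-zero part of the spectrum. -/
lemma specProj_filterOp [FiniteDimensional ℂ E]
    (hP : ∀ u ∈ E, L.starProjection u = 0 → u = 0) {γ : ℝ} (hγ0 : 0 < γ)
    (hγ : IsLeast (spectrum ℝ (filterOp E L) \ {0}) γ) {r : ℝ} (hr : 1 ≤ r) (x : H) :
    specProj (filterOp E L) (Icc (γ / 2) r) x = E.starProjection x := by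
  set T := filterOp E L with hT
  have hsa : IsSelfAdjoint T := filterOp_isSelfAdjoint E L
  have hfin : (spectrum ℝ T).Finite := filterOp_finite_spectrum
  have hsep : Separated T (Icc (γ / 2) r) := separated_of_finite hfin _
  have key : ∀ u ∈ E, specProj T (Icc (γ / 2) r) u = u := by
    intro v hv
    set z := v - specProj T (Icc (γ / 2) r) v with hz
    have hzc : specProj T (Icc (γ / 2) r)ᶜ v = z := specProj_compl_apply hsa hsep v
    have hzz : specProj T (Icc (γ / 2) r)ᶜ z = z := by
      rw [← hzc, specProj_idem hsep.compl]
    have hTz : T z = 0 := by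
      have := norm_sub_smul_specProj_le hsa hsep.compl (c := 0) (r := 0) le_rfl (by
        rintro τ ⟨hτ, hτs⟩
        by_contra hτ0
        rw [sub_zero, abs_nonpos_iff] at hτ0
        have h1 : γ ≤ τ := hγ.2 ⟨hτ, hτ0⟩
        obtain ⟨w, hw0, hw⟩ := filterOp_exists_eigenvector hτ
        exact hτs ⟨by linarith, (filterOp_eigenvalue_mem hw0 hw).2.trans hr⟩) hzz
      simpa using this
    have hEz := starProjection_eq_zero_of_filterOp hP hTz
    have h0 : inner ℂ z z = 0 := by
      calc inner ℂ z z = inner ℂ (specProj T (Icc (γ / 2) r)ᶜ v) z := by rw [hzc]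
        _ = inner ℂ v z := by rw [specProj_inner, hzz]
        _ = inner ℂ v (E.starProjection z) := by
          rw [← Submodule.inner_starProjection_left_eq_right,
            Submodule.starProjection_eq_self_iff.2 hv]
        _ = 0 := by rw [hEz, inner_zero_right]
    rw [inner_self_eq_zero, hz, sub_eq_zero] at h0
    exact h0.symm
  symm
  refine Submodule.eq_starProjection_of_mem_of_inner_eq_zero ?_ fun w hw => ?_
  · have h1 := (specProj_eq_self_iff hsa hsep (hfin.subset inter_subset_left)).1
      (specProj_idem hsep x)
    refine eigSup_filterOp_le (L := L) ?_ h1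
    rintro ⟨h, -⟩
    linarith
  · rw [← key w hw, ← specProj_inner, map_sub, specProj_idem hsep, sub_self, inner_zero_left]

/-- If the orthogonal projections `Qₙ` onto `Gₙ` converge strongly to the one onto `E`, then the
spectral subspaces of `Qₙ P Qₙ` above `γ / 2` converge to `E`: since `P` has finite rank,
`Qₙ P → E P` in norm, which bounds the distance from these subspaces to `E`, and strong convergence
of the spectral projections gives the other direction. -/
theorem filterOp_subClose [FiniteDimensional ℂ E] [FiniteDimensional ℂ L]
    {G : ℕ → Submodule ℂ H} [∀ n, FiniteDimensional ℂ (G n)]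
    (hQ : ∀ x, Tendsto (fun n => (G n).starProjection x) atTop (𝓝 (E.starProjection x)))
    (hP : ∀ u ∈ E, L.starProjection u = 0 → u = 0) {γ : ℝ} (hγ0 : 0 < γ)
    (hγ : IsLeast (spectrum ℝ (filterOp E L) \ {0}) γ) {ε : ℝ} (hε : 0 < ε) :
    ∀ᶠ n in atTop, SubClose (eigSup (filterOp (G n) L) (Icc (γ / 2) 1)) E ε ∧
      SubClose E (eigSup (filterOp (G n) L) (Icc (γ / 2) 1)) ε := by
  have h1 := eventually_norm_le_of_finiteDimensional L
    (B := fun n => (G n).starProjection - E.starProjection)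
    (fun x _ => by simpa using (hQ x).sub_const (E.starProjection x))
    (ε := ε * (γ / 2)) (by positivity)
  have hconv : ∀ x, Tendsto (fun n => filterOp (G n) L x) atTop (𝓝 (filterOp E L x)) := by
    intro x
    have e1 : Tendsto (fun n => L.starProjection ((G n).starProjection x)) atTop
        (𝓝 (L.starProjection (E.starProjection x))) :=
      (L.starProjection.continuous.tendsto _).comp (hQ x)
    have e2 : Tendsto (fun n => (G n).starProjection (L.starProjection ((G n).starProjection x)
        - L.starProjection (E.starProjection x))) atTop (𝓝 0) := by
      refine squeeze_zero_norm (fun n => Submodule.norm_starProjection_apply_le _ _) ?_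
      have := e1.sub_const (L.starProjection (E.starProjection x))
      rw [sub_self] at this
      simpa using this.norm
    have e3 := e2.add (hQ (L.starProjection (E.starProjection x)))
    rw [zero_add] at e3
    refine e3.congr fun n => ?_
    rw [map_sub, sub_add_cancel, filterOp_apply]
  have hγ1 : γ ≤ 1 := by
    obtain ⟨w, hw0, hw⟩ := filterOp_exists_eigenvector hγ.1.1
    exact (filterOp_eigenvalue_mem hw0 hw).2
  have hfinn : ∀ n, (spectrum ℝ (filterOp (G n) L)).Finite := fun n => filterOp_finite_spectrum
  have hsepn : ∀ n, Separated (filterOp (G n) L) (Icc (γ / 2) 2) := fun n =>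
    separated_of_finite (hfinn n) _
  have hmem : ∀ n x, specProj (filterOp (G n) L) (Icc (γ / 2) 2) x = x ↔
      x ∈ eigSup (filterOp (G n) L) (Icc (γ / 2) 1) := fun n x => by
    rw [eigSup_filterOp_Icc (γ / 2) one_le_two]
    exact specProj_eq_self_iff (filterOp_isSelfAdjoint _ _) (hsepn n)
      ((hfinn n).subset inter_subset_left)
  have hΦ := specProj_tendsto (filterOp_isSelfAdjoint E L)
    (fun n => filterOp_isSelfAdjoint (G n) L) hconv (α := γ / 2) (β := 2) (by linarith)
    (fun h => by
      have := hγ.2 ⟨h, (by positivity : γ / 2 ≠ 0)⟩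
      linarith)
    (fun h => by
      obtain ⟨w, hw0, hw⟩ := filterOp_exists_eigenvector h
      have := (filterOp_eigenvalue_mem hw0 hw).2
      linarith)
    hsepn (filterOp_finite_spectrum.subset inter_subset_left)
  have h2 := eventually_norm_le_of_finiteDimensional E
    (B := fun n => specProj (filterOp (G n) L) (Icc (γ / 2) 2) - E.starProjection)
    (fun x _ => by
      have := (hΦ x).sub_const (E.starProjection x)
      rw [specProj_filterOp hP hγ0 hγ one_le_two, sub_self] at this
      simpa using this) hε
  filter_upwards [h1, h2] with n h1 h2
  constructor
  · intro u hu
    obtain ⟨w, hw, hwu, hwn⟩ := exists_preimage (filterOp_isSelfAdjoint (G n) L) (hsepn n)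
      (c := 0) (d := γ / 2) (by positivity)
      (by rintro x ⟨-, hx, -⟩; rw [sub_zero]; exact hx.trans (le_abs_self x))
      ((hmem n u).2 hu)
    have hwG : w ∈ G n := eigSup_filterOp_le (L := L) (by rintro ⟨h, -⟩; linarith)
      ((hmem n w).1 hw)
    rw [Complex.ofReal_zero, zero_smul, sub_zero, filterOp_apply,
      Submodule.starProjection_eq_self_iff.2 hwG] at hwu
    refine ⟨E.starProjection (L.starProjection w), Submodule.starProjection_apply_mem _ _, ?_⟩
    have h3 := h1 _ (Submodule.starProjection_apply_mem L w)
    rw [_root_.sub_apply, hwu] at h3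
    calc ‖u - E.starProjection (L.starProjection w)‖
        ≤ ε * (γ / 2) * ‖L.starProjection w‖ := h3
      _ ≤ ε * (γ / 2) * ‖w‖ := by gcongr; exact Submodule.norm_starProjection_apply_le _ _
      _ = ε * (γ / 2 * ‖w‖) := by ring
      _ ≤ ε * ‖u‖ := by gcongr
  · intro u hu
    refine ⟨_, (hmem n _).1 (specProj_idem (hsepn n) u), ?_⟩
    have := h2 u hu
    rw [_root_.sub_apply, Submodule.starProjection_eq_self_iff.2 hu] at this
    rwa [norm_sub_rev]

end Filtering

/-! ### Closeness in the form norm -/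

section FormClose

/-- Closeness of subspaces of `S Wₙ` to `E` carries over to the preimages under `S`, since `S` is
bounded below on the `Wₙ` uniformly and since vectors of `E` are approximated by the `Wₙ`. -/
theorem subClose_comap {S : H →L[ℂ] H} (hinj : Function.Injective S) (hS1 : ∀ x, ‖S x‖ ≤ ‖x‖)
    {E : Submodule ℂ H} [FiniteDimensional ℂ E] {W M : ℕ → Submodule ℂ H}
    [∀ n, (W n).HasOrthogonalProjection]
    (hconv : ∀ x ∈ E, Tendsto (fun n => (W n).starProjection x) atTop (𝓝 x))
    (hSE : ∀ u ∈ E, S u ∈ E) (hES : ∀ u ∈ E, ∃ x ∈ E, S x = u) {C : ℝ} (hC : 0 ≤ C)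
    (hW : ∀ n, ∀ y ∈ W n, ‖y‖ ≤ C * ‖S y‖) (hE : ∀ y ∈ E, ‖y‖ ≤ C * ‖S y‖)
    (hM : ∀ n, M n ≤ (W n).map (S : H →ₗ[ℂ] H))
    (hclose : ∀ ε > 0, ∀ᶠ n in atTop, SubClose (M n) E ε ∧ SubClose E (M n) ε)
    {ε : ℝ} (hε : 0 < ε) :
    ∀ᶠ n in atTop, SubClose ((M n).comap (S : H →ₗ[ℂ] H)) E ε ∧
      SubClose E ((M n).comap (S : H →ₗ[ℂ] H)) ε := by
  set η := min 1 (ε / ((1 + C) * (1 + 2 * C))) with hη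
  have hη0 : 0 < η := by positivity
  have hη1 : η ≤ 1 := min_le_left _ _
  have hηε : η * ((1 + C) * (1 + 2 * C)) ≤ ε := by
    rw [← le_div_iff₀ (by positivity)]; exact min_le_right _ _
  have h1 := eventually_norm_le_of_finiteDimensional E
    (B := fun n => 1 - (W n).starProjection)
    (fun x hx => by simpa using (hconv x hx).const_sub x) hη0
  filter_upwards [h1, hclose η hη0] with n h1 ⟨h2, h3⟩
  -- the distance of `x ∈ E` and `y ∈ W n` in terms of that of `S x` and `S y`
  have key : ∀ x ∈ E, ∀ y ∈ W n, ‖x - y‖ ≤ (1 + C) * (η * ‖x‖) + C * ‖S x - S y‖ := by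
    intro x hx y hy
    set p := (W n).starProjection x with hp
    have e1 : ‖x - p‖ ≤ η * ‖x‖ := h1 x hx
    have e2 : ‖p - y‖ ≤ C * ‖S (p - y)‖ :=
      hW n _ ((W n).sub_mem (Submodule.starProjection_apply_mem _ _) hy)
    have e3 : ‖S (p - y)‖ ≤ ‖x - p‖ + ‖S x - S y‖ := by
      have : S (p - y) = (S x - S y) - S (x - p) := by simp only [map_sub]; abel
      rw [this]
      refine (norm_sub_le _ _).trans ?_
      have := hS1 (x - p)
      linarith
    have e4 : ‖x - y‖ ≤ ‖x - p‖ + ‖p - y‖ := norm_sub_le_norm_sub_add_norm_sub _ _ _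
    have e5 : C * ‖S (p - y)‖ ≤ C * (η * ‖x‖ + ‖S x - S y‖) := by gcongr; linarith
    calc ‖x - y‖ ≤ η * ‖x‖ + C * (η * ‖x‖ + ‖S x - S y‖) := by linarith
      _ = _ := by ring
  have hmem : ∀ y, S y ∈ M n → y ∈ W n := by
    intro y hy
    obtain ⟨w, hw, hwy⟩ := hM n hy
    rwa [← hinj hwy]
  constructor
  · intro y hy
    have hy' : S y ∈ M n := hy
    obtain ⟨v, hv, hvn⟩ := h2 _ hy'
    obtain ⟨x, hx, rfl⟩ := hES v hv
    refine ⟨x, hx, ?_⟩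
    have a1 := key x hx y (hmem y hy')
    have a2 : ‖S y - S x‖ ≤ η * ‖y‖ := hvn.trans (by gcongr; exact hS1 y)
    have a3 : ‖x‖ ≤ 2 * C * ‖y‖ := by
      have b1 : ‖S x‖ ≤ ‖S y‖ + ‖S y - S x‖ := by
        have := norm_sub_le (S y) (S y - S x)
        simpa using this
      have b2 := hS1 y
      have b3 : η * ‖y‖ ≤ 1 * ‖y‖ := by gcongr
      calc ‖x‖ ≤ C * ‖S x‖ := hE x hx
        _ ≤ C * (2 * ‖y‖) := by gcongr; linarith
        _ = _ := by ring
    rw [norm_sub_rev] at a1 a2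
    calc ‖y - x‖ ≤ (1 + C) * (η * (2 * C * ‖y‖)) + C * (η * ‖y‖) := by
          refine a1.trans ?_
          gcongr
      _ ≤ η * ((1 + C) * (1 + 2 * C)) * ‖y‖ := by
          have : 0 ≤ η * ‖y‖ := by positivity
          nlinarith
      _ ≤ ε * ‖y‖ := by gcongr
  · intro x hx
    obtain ⟨v, hv, hvn⟩ := h3 _ (hSE x hx)
    obtain ⟨y, hy, rfl⟩ := hM n hv
    refine ⟨y, hv, ?_⟩
    have a1 := key x hx y hy
    have a2 : ‖S x - S y‖ ≤ η * ‖x‖ := hvn.trans (by gcongr; exact hS1 x)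
    calc ‖x - y‖ ≤ (1 + C) * (η * ‖x‖) + C * (η * ‖x‖) := by
          refine a1.trans ?_
          gcongr
      _ ≤ η * ((1 + C) * (1 + 2 * C)) * ‖x‖ := by
          have h0 : 0 ≤ η * ‖x‖ := by positivity
          have : 0 ≤ η * ‖x‖ * C := by positivity
          have : 0 ≤ η * ‖x‖ * C * C := by positivity
          nlinarith
      _ ≤ ε * ‖x‖ := by gcongr

end FormClose

/-! ### Ritz values -/

section Ritz

variable {R : H →L[ℂ] H} {s : Set ℝ} {E M : Submodule ℂ H} [M.HasOrthogonalProjection] {η ε : ℝ}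

lemma SubClose.norm_sub_starProjection_le {K : Submodule ℂ H} (h : SubClose K M η) {u : H}
    (hu : u ∈ K) : ‖u - M.starProjection u‖ ≤ η * ‖u‖ := by
  obtain ⟨v, hv, hvn⟩ := h u hu
  exact (GalerkinSpectral.norm_sub_starProjection_le M u hv).trans hvn

variable [CompleteSpace H]

/-- A Ritz value of `R` in a subspace `M` close to the spectral subspace `E` of `R` is close to the
corresponding part of the spectrum. -/
lemma exists_spectrum_near_ritz (hR : IsSelfAdjoint R) (hR1 : ∀ x, ‖R x‖ ≤ ‖x‖)
    (hsep : Separated R s) (hE : ∀ y ∈ E, specProj R s y = y) (hRE : ∀ y ∈ E, R y ∈ E)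
    (h1 : SubClose M E η) (h2 : SubClose E M η) (hη : 0 ≤ η) (hε : 0 < ε) (hε1 : ε ≤ 1)
    (hηε : 10 * η ≤ ε) {τ : ℝ} {x : H} (hxM : x ∈ M) (hx0 : x ≠ 0)
    (hx : M.starProjection (R x) = (τ : ℂ) • x) : ∃ σ ∈ spectrum ℝ R ∩ s, |σ - τ| < ε := by
  by_contra! hc
  obtain ⟨y, hy, hxy⟩ := h1 x hxM
  have hn : 0 < ‖x‖ := norm_pos_iff.2 hx0
  have e1 : ε * ‖y‖ ≤ ‖R y - (τ : ℂ) • y‖ := by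
    have := mul_norm_specProj_le hR hsep hε hc y
    rwa [hE y hy] at this
  have hτ : ‖(τ : ℂ)‖ ≤ 1 := by
    have : ‖(τ : ℂ) • x‖ ≤ ‖x‖ := by
      rw [← hx]
      exact (Submodule.norm_starProjection_apply_le _ _).trans (hR1 x)
    rw [norm_smul] at this
    by_contra! h'
    nlinarith
  have e2 : ‖R y - M.starProjection (R y)‖ ≤ η * ‖y‖ :=
    (h2.norm_sub_starProjection_le (hRE y hy)).trans (by gcongr; exact hR1 y)
  have e3 : ‖M.starProjection (R (y - x))‖ ≤ ‖x - y‖ := by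
    rw [norm_sub_rev]
    exact (Submodule.norm_starProjection_apply_le _ _).trans (hR1 _)
  have e4 : ‖(τ : ℂ) • (x - y)‖ ≤ ‖x - y‖ := by
    rw [norm_smul]
    exact mul_le_of_le_one_left (norm_nonneg _) hτ
  have e5 : R y - (τ : ℂ) • y = (R y - M.starProjection (R y)) + M.starProjection (R (y - x))
      + (τ : ℂ) • (x - y) := by
    simp only [map_sub, smul_sub, hx]; abel
  have e6 : ‖R y - (τ : ℂ) • y‖ ≤ η * ‖y‖ + ‖x - y‖ + ‖x - y‖ := by
    rw [e5]
    refine (norm_add_le _ _).trans (add_le_add ((norm_add_le _ _).trans (add_le_add e2 e3)) e4)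
  have e7 : ‖x‖ ≤ ‖y‖ + ‖x - y‖ := by
    have := norm_add_le y (x - y)
    simpa using this
  have e8 : ‖y‖ ≤ ‖x‖ + ‖x - y‖ := by
    have := norm_sub_le x (x - y)
    simpa using this
  have e9 : 10 * (η * ‖x‖) ≤ ε * ‖x‖ := by nlinarith
  have e10 : 10 * (η * ‖y‖) ≤ ε * ‖y‖ := by nlinarith [norm_nonneg y]
  have e11 : ε * ‖x‖ ≤ 1 * ‖x‖ := by gcongr
  have e12 : 0 < ε * ‖x‖ := by positivity
  have e13 : ε * ‖x‖ ≤ ε * (‖y‖ + η * ‖x‖) := by gcongr; linarith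
  have e14 : ε * (η * ‖x‖) ≤ 1 * (η * ‖x‖) := by gcongr
  nlinarith

/-- Each spectral point of `R` with an eigenvector in `E` is close to a Ritz value of `R` in a
subspace `M` close to `E`. -/
lemma exists_ritz_near_spectrum [FiniteDimensional ℂ M] (hR : IsSelfAdjoint R)
    (hR1 : ∀ x, ‖R x‖ ≤ ‖x‖) (h2 : SubClose E M η) (hη : 0 ≤ η) (hε : 0 < ε) (hε1 : ε ≤ 1)
    (hηε : 10 * η ≤ ε) {σ : ℝ} (hσ : ε ≤ σ) {y : H} (hyE : y ∈ E) (hy0 : y ≠ 0)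
    (hy : R y = (σ : ℂ) • y) :
    ∃ τ : ℝ, |τ - σ| < ε ∧ ∃ x ∈ M, x ≠ 0 ∧ M.starProjection (R x) = (τ : ℂ) • x := by
  set B : H →L[ℂ] H := M.starProjection * R * M.starProjection with hB
  have hBa : ∀ x, B x = M.starProjection (R (M.starProjection x)) := fun _ => rfl
  have hBsa : IsSelfAdjoint B := compression_isSelfAdjoint hR M
  have hBfin : (spectrum ℝ B).Finite :=
    finite_real_spectrum (finite_spectrum_of_range_le M
      fun x => Submodule.starProjection_apply_mem _ _)
  have hn : 0 < ‖y‖ := norm_pos_iff.2 hy0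
  obtain ⟨τ, hτ, hτσ⟩ : ∃ τ ∈ spectrum ℝ B, |τ - σ| < ε := by
    by_contra! hc
    set x := M.starProjection y with hx
    have hxx : M.starProjection x = x :=
      Submodule.starProjection_eq_self_iff.2 (Submodule.starProjection_apply_mem _ _)
    have e0 : ‖y - x‖ ≤ η * ‖y‖ := h2.norm_sub_starProjection_le hyE
    have huniv : specProj B univ x = x := by simp [specProj, cfc_one ℝ B]
    have e1 := mul_norm_specProj_le hBsa (separated_of_finite hBfin univ) hε
      (fun τ hτ => hc τ hτ.1) x
    rw [huniv] at e1
    have e2 : B x - (σ : ℂ) • x = M.starProjection (R (x - y)) := by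
      rw [hBa, hxx, map_sub, hy, map_sub, map_smul]
    have e3 : ‖B x - (σ : ℂ) • x‖ ≤ ‖y - x‖ := by
      rw [e2, norm_sub_rev y x]
      exact (Submodule.norm_starProjection_apply_le _ _).trans (hR1 _)
    have e4 : ‖y‖ ≤ ‖x‖ + ‖y - x‖ := by
      have := norm_add_le x (y - x)
      simpa using this
    have e5 : 10 * (η * ‖y‖) ≤ ε * ‖y‖ := by nlinarith
    have e6 : ε * ‖y‖ ≤ ε * (‖x‖ + η * ‖y‖) := by gcongr; linarith
    have e7 : ε * (η * ‖y‖) ≤ 1 * (η * ‖y‖) := by gcongr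
    have e8 : 0 < ε * ‖y‖ := by positivity
    linarith
  have hτ0 : τ ≠ 0 := by
    rintro rfl
    rw [zero_sub, abs_neg] at hτσ
    have := le_abs_self σ
    linarith
  obtain ⟨x, hx0, hx⟩ := exists_eigenvector hBsa (separated_of_finite hBfin _) hτ
  have hxM : x ∈ M := by
    have : x = (τ : ℂ)⁻¹ • B x := by
      rw [hx, smul_smul, inv_mul_cancel₀ (by exact_mod_cast hτ0), one_smul]
    rw [this]
    exact M.smul_mem _ (Submodule.starProjection_apply_mem _ _)
  refine ⟨τ, hτσ, x, hxM, hx0, ?_⟩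
  rwa [hBa, Submodule.starProjection_eq_self_iff.2 hxM] at hx

end Ritz

/-! ### The resolvent of a self-adjoint operator that is bounded below -/

section Resolvent

variable {A : H →ₗ.[ℂ] H}

lemma mem_eigSpace_iff {z : ℂ} {x : H} :
    x ∈ eigSpace A z ↔ ∃ h : x ∈ A.domain, A ⟨x, h⟩ = z • x := by
  simp only [eigSpace, Submodule.mem_map, LinearMap.mem_ker, LinearMap.sub_apply,
    LinearMap.smul_apply, Submodule.subtype_apply, sub_eq_zero]
  constructor
  · rintro ⟨y, hy, rfl⟩
    exact ⟨y.2, hy⟩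
  · rintro ⟨h, hx⟩
    exact ⟨⟨x, h⟩, hx, rfl⟩

lemma inner_apply_eq_of_isSelfAdjoint [CompleteSpace H] (hA : IsSelfAdjoint A) (u v : A.domain) :
    inner ℂ (A u) (v : H) = inner ℂ (u : H) (A v) := by
  have h := LinearPMap.adjoint_isFormalAdjoint (T := A) hA.dense_domain
  rw [LinearPMap.isSelfAdjoint_def.1 hA] at h
  exact h u v

/-- Real numbers below a lower bound of a self-adjoint operator are in its resolvent set. -/
lemma mem_resSet_of_lt [CompleteSpace H] (hA : IsSelfAdjoint A) {c : ℝ}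
    (hc : ∀ u : A.domain, c * ‖(u : H)‖ ^ 2 ≤ (inner ℂ (A u) (u : H)).re) {z : ℝ} (hz : z < c) :
    (z : ℂ) ∈ resSet A := by
  set f : A.domain →ₗ[ℂ] H := A.toFun - (z : ℂ) • A.domain.subtype with hf
  have hfa : ∀ u, f u = A u - (z : ℂ) • (u : H) := fun _ => rfl
  have hcz : 0 < c - z := by linarith
  have hre : ∀ u : A.domain, (c - z) * ‖(u : H)‖ ^ 2 ≤ (inner ℂ (f u) (u : H)).re := by
    intro u
    have h2 : (inner ℂ (f u) (u : H)).re = (inner ℂ (A u) (u : H)).re - z * ‖(u : H)‖ ^ 2 := by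
      rw [hfa, inner_sub_left, inner_smul_left, inner_self_eq_norm_sq_to_K]
      simp [← Complex.ofReal_pow]
    rw [h2]
    have := hc u
    linarith
  have hlow : ∀ u : A.domain, (c - z) * ‖(u : H)‖ ≤ ‖f u‖ := by
    intro u
    by_cases hu : ‖(u : H)‖ = 0
    · rw [hu]; simp
    have hu0 : 0 < ‖(u : H)‖ := lt_of_le_of_ne (norm_nonneg _) (Ne.symm hu)
    have h1 := (hre u).trans ((Complex.re_le_norm _).trans (norm_inner_le_norm _ _))
    have h2 : ‖(u : H)‖ * ((c - z) * ‖(u : H)‖) ≤ ‖(u : H)‖ * ‖f u‖ := by nlinarith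
    exact le_of_mul_le_mul_left h2 hu0
  have hinj : Function.Injective f := by
    rw [← LinearMap.ker_eq_bot, LinearMap.ker_eq_bot']
    intro u hu
    have := hlow u
    rw [hu, norm_zero] at this
    have h0 : ‖(u : H)‖ ≤ 0 := by
      by_contra! h'
      nlinarith
    exact Subtype.ext (norm_le_zero_iff.1 h0)
  -- The range is the image of the graph, a complete space, under a map bounded below.
  have hclosed : IsClosed (LinearMap.range f : Set H) := by
    have hg : IsClosed (A.graph : Set (H × H)) := hA.isClosed
    have : CompleteSpace A.graph := hg.completeSpace_coe
    set Φ : A.graph →L[ℂ] H := (ContinuousLinearMap.snd ℂ H H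
      - (z : ℂ) • ContinuousLinearMap.fst ℂ H H).comp A.graph.subtypeL with hΦ
    have hΦa : ∀ u : A.domain, Φ ⟨(u, A u), A.mem_graph u⟩ = f u := fun _ => rfl
    have hgr : ∀ p : A.graph, ∃ u : A.domain, p = ⟨(u, A u), A.mem_graph u⟩ := by
      rintro ⟨p, hp⟩
      obtain ⟨u, h1, h2⟩ := (LinearPMap.mem_graph_iff A).1 hp
      exact ⟨u, Subtype.ext (Prod.ext h1.symm h2.symm)⟩
    set C : ℝ := 1 / (c - z) + (1 + |z| / (c - z)) with hC
    have hC0 : 0 ≤ C := by positivity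
    have hanti : AntilipschitzWith ⟨C, hC0⟩ Φ := by
      refine AddMonoidHomClass.antilipschitz_of_bound Φ fun p => ?_
      obtain ⟨u, rfl⟩ := hgr p
      rw [hΦa]
      change max ‖(u : H)‖ ‖A u‖ ≤ C * ‖f u‖
      have e1 : ‖(u : H)‖ ≤ 1 / (c - z) * ‖f u‖ := by
        rw [div_mul_eq_mul_div, le_div_iff₀ hcz]
        have := hlow u
        linarith
      have e2 : ‖A u‖ ≤ ‖f u‖ + |z| * ‖(u : H)‖ := by
        have : A u = f u + (z : ℂ) • (u : H) := by rw [hfa]; abel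
        rw [this]
        refine (norm_add_le _ _).trans ?_
        rw [norm_smul, Complex.norm_real, Real.norm_eq_abs]
      have e3 : |z| * ‖(u : H)‖ ≤ |z| / (c - z) * ‖f u‖ := by
        calc |z| * ‖(u : H)‖ ≤ |z| * (1 / (c - z) * ‖f u‖) := by gcongr
          _ = _ := by ring
      have p1 : 0 ≤ 1 / (c - z) * ‖f u‖ := by positivity
      have p2 : 0 ≤ |z| / (c - z) * ‖f u‖ := by positivity
      have p3 := norm_nonneg (f u)
      have : C * ‖f u‖ = 1 / (c - z) * ‖f u‖ + (‖f u‖ + |z| / (c - z) * ‖f u‖) := by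
        rw [hC]; ring
      rw [this]
      exact max_le (by linarith) (by linarith)
    have hr := hanti.isClosed_range Φ.uniformContinuous
    convert hr using 1
    ext y
    constructor
    · rintro ⟨u, rfl⟩; exact ⟨_, hΦa u⟩
    · rintro ⟨p, rfl⟩
      obtain ⟨u, rfl⟩ := hgr p
      exact ⟨u, (hΦa u).symm⟩
  have hsurj : Function.Surjective f := by
    rw [← LinearMap.range_eq_top]
    have : CompleteSpace (LinearMap.range f) := hclosed.completeSpace_coe
    rw [← Submodule.orthogonal_eq_bot_iff, Submodule.eq_bot_iff]
    intro v hv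
    have hv' : ∀ u, inner ℂ (f u) v = 0 := fun u => hv _ ⟨u, rfl⟩
    have hvd : v ∈ A.domain := by
      rw [← LinearPMap.isSelfAdjoint_def.1 hA]
      refine LinearPMap.mem_adjoint_domain_of_exists v ⟨(z : ℂ) • v, fun x => ?_⟩
      have h1 := hv' x
      rw [hfa, inner_sub_left, sub_eq_zero] at h1
      rw [← inner_conj_symm v, h1, inner_conj_symm, inner_smul_left, inner_smul_right,
        Complex.conj_ofReal]
    have h1 := hre ⟨v, hvd⟩
    rw [hv'] at h1
    have h0 : ‖v‖ ≤ 0 := by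
      by_contra! h'
      have : 0 < (c - z) * ‖v‖ ^ 2 := by positivity
      exact absurd h1 (by simpa using this)
    exact norm_le_zero_iff.1 h0
  set e := LinearEquiv.ofBijective f ⟨hinj, hsurj⟩ with he
  have hef : ∀ x, f (e.symm x) = x := fun x => e.apply_symm_apply x
  refine ⟨LinearMap.mkContinuous (A.domain.subtype.comp (e.symm : H →ₗ[ℂ] A.domain)) (1 / (c - z))
    fun x => ?_, fun x => ⟨(e.symm x).2, ?_⟩, fun u => ?_⟩
  · have := hlow (e.symm x)
    rw [hef] at this
    change ‖((e.symm x : A.domain) : H)‖ ≤ _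
    rw [div_mul_eq_mul_div, le_div_iff₀ hcz]
    linarith
  · exact hef x
  · exact congr_arg Subtype.val (e.symm_apply_apply u)

lemma bddBelow_spec [CompleteSpace H] (hA : IsSelfAdjoint A)
    (hbelow : ∃ c : ℝ, ∀ u : A.domain, c * ‖(u : H)‖ ^ 2 ≤ (inner ℂ (A u) (u : H)).re) :
    BddBelow (realPts (spec A)) := by
  obtain ⟨c, hc⟩ := hbelow
  refine ⟨c, fun z hz => ?_⟩
  by_contra! h
  exact hz (mem_resSet_of_lt hA hc h)

variable {z : ℝ} {R : H →L[ℂ] H}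

lemma IsResolventAt.isSelfAdjoint [CompleteSpace H] (hA : IsSelfAdjoint A)
    (hR : IsResolventAt A z R) : IsSelfAdjoint R := by
  rw [ContinuousLinearMap.isSelfAdjoint_iff_isSymmetric]
  intro x y
  obtain ⟨hx, hx'⟩ := hR.1 x
  obtain ⟨hy, hy'⟩ := hR.1 y
  have h := inner_apply_eq_of_isSelfAdjoint hA ⟨R x, hx⟩ ⟨R y, hy⟩
  change inner ℂ (R x) y = inner ℂ x (R y)
  conv_lhs => rw [← hy']
  conv_rhs => rw [← hx']
  rw [inner_sub_right, inner_sub_left, h, inner_smul_left, inner_smul_right, Complex.conj_ofReal]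

lemma IsResolventAt.injective {z : ℂ} (hR : IsResolventAt A z R) : Function.Injective R := by
  rw [injective_iff_map_eq_zero]
  intro x hx
  obtain ⟨h, h'⟩ := hR.1 x
  have : (⟨R x, h⟩ : A.domain) = 0 := Subtype.ext hx
  rw [← h', this, hx]; simp

lemma IsResolventAt.mem_eigSpace_iff (hR : IsResolventAt A z R) {τ : ℝ} (hτ : τ ≠ 0) {x : H} :
    x ∈ eigSpace A ((z + τ⁻¹ : ℝ) : ℂ) ↔ R x = (τ : ℂ) • x := by
  have hτ' : (τ : ℂ) ≠ 0 := by exact_mod_cast hτ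
  rw [GalerkinSpectral.mem_eigSpace_iff]
  constructor
  · rintro ⟨h, hx⟩
    have := hR.2 ⟨x, h⟩
    rw [hx, ← sub_smul] at this
    push_cast at this
    rw [add_sub_cancel_left, map_smul] at this
    change (τ : ℂ)⁻¹ • R x = x at this
    conv_rhs => rw [← this]
    rw [smul_smul, mul_inv_cancel₀ hτ', one_smul]
  · intro hx
    have hx1 : R ((τ : ℂ)⁻¹ • x) = x := by
      rw [map_smul, hx, smul_smul, inv_mul_cancel₀ hτ', one_smul]
    obtain ⟨h, h'⟩ := hR.1 ((τ : ℂ)⁻¹ • x)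
    simp only [hx1] at h h'
    refine ⟨h, ?_⟩
    rw [sub_eq_iff_eq_add] at h'
    rw [h']
    push_cast
    rw [add_smul, add_comm]

/-- The spectral mapping property of the resolvent: `τ - R` is invertible if `A - (z + τ⁻¹)` is, by
the resolvent identity. -/
lemma IsResolventAt.notMem_spectrum (hR : IsResolventAt A z R) {τ : ℝ} (hτ : τ ≠ 0)
    (h : ((z + τ⁻¹ : ℝ) : ℂ) ∈ resSet A) : τ ∉ spectrum ℝ R := by
  obtain ⟨R', hR'⟩ := h
  set w : ℂ := (τ : ℂ)⁻¹ with hw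
  have hτ' : (τ : ℂ) ≠ 0 := by exact_mod_cast hτ
  have hzw : ((z + τ⁻¹ : ℝ) : ℂ) = z + w := by rw [hw]; push_cast; rfl
  rw [hzw] at hR'
  have i1 : ∀ x, R (x + w • R' x) = R' x := by
    intro x
    obtain ⟨h, h'⟩ := hR'.1 x
    have h2 := hR.2 ⟨R' x, h⟩
    have : A ⟨R' x, h⟩ - (z : ℂ) • R' x = x + w • R' x := by
      rw [sub_eq_iff_eq_add] at h'
      rw [h', add_smul]; abel
    rwa [this] at h2
  have i2 : ∀ x, R' (x - w • R x) = R x := by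
    intro x
    obtain ⟨h, h'⟩ := hR.1 x
    have h2 := hR'.2 ⟨R x, h⟩
    have : A ⟨R x, h⟩ - ((z : ℂ) + w) • R x = x - w • R x := by
      rw [sub_eq_iff_eq_add] at h'
      rw [h', add_smul]; abel
    rwa [this] at h2
  rw [spectrum.notMem_iff]
  have hinv : ∀ x, (algebraMap ℝ (H →L[ℂ] H) τ - R) x = (τ : ℂ) • x - R x := fun x => by
    change (τ : ℝ) • x - R x = _
    simp
  refine ⟨⟨algebraMap ℝ (H →L[ℂ] H) τ - R, w • (1 + w • R'), ?_, ?_⟩, rfl⟩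
  · ext x
    change (algebraMap ℝ (H →L[ℂ] H) τ - R) (w • (x + w • R' x)) = x
    rw [hinv, map_smul, i1, smul_smul, mul_inv_cancel₀ hτ', one_smul, add_sub_cancel_right]
  · ext x
    change w • ((algebraMap ℝ (H →L[ℂ] H) τ - R) x
      + w • R' ((algebraMap ℝ (H →L[ℂ] H) τ - R) x)) = x
    have e : (τ : ℂ) • x - R x = (τ : ℂ) • (x - w • R x) := by
      rw [smul_sub, smul_smul, mul_inv_cancel₀ hτ', one_smul]
    rw [hinv, e, map_smul, i2, smul_smul, inv_mul_cancel₀ hτ', one_smul, ← e, sub_add_cancel,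
      smul_smul, inv_mul_cancel₀ hτ', one_smul]

lemma isResolventAt_res {z : ℂ} (h : z ∈ resSet A) : IsResolventAt A z (res A z) := by
  have h' : ∃ R : H →L[ℂ] H, IsResolventAt A z R := h
  unfold res
  rw [dif_pos h']
  exact h'.choose_spec

end Resolvent

/-! ### The bounded operator `(A - m + 1)⁻¹` and its square root -/

section Shift

variable [CompleteSpace H] {A : H →ₗ.[ℂ] H}

/-- The operator `(A - m + 1)⁻¹`. -/
def shiftRes (A : H →ₗ.[ℂ] H) : H →L[ℂ] H := res A ((specMin A - 1 : ℝ) : ℂ)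

/-- The operator `(A - m + 1)^{-1/2}`. -/
def sqrtRes (A : H →ₗ.[ℂ] H) : H →L[ℂ] H := CFC.sqrt (shiftRes A)

/-- The eigenvalue of `A` that corresponds to the eigenvalue `τ` of `(A - m + 1)⁻¹`. -/
def unshift (A : H →ₗ.[ℂ] H) (τ : ℝ) : ℝ := specMin A - 1 + τ⁻¹

lemma sqrtRes_isSelfAdjoint (A : H →ₗ.[ℂ] H) : IsSelfAdjoint (sqrtRes A) :=
  IsSelfAdjoint.of_nonneg (CFC.sqrt_nonneg _)

section Basic

variable (hA : IsSelfAdjoint A)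
  (hbelow : ∃ c : ℝ, ∀ u : A.domain, c * ‖(u : H)‖ ^ 2 ≤ (inner ℂ (A u) (u : H)).re)
include hA hbelow

lemma specMin_le {μ : ℝ} (hμ : (μ : ℂ) ∈ spec A) : specMin A ≤ μ :=
  csInf_le (bddBelow_spec hA hbelow) hμ

lemma shiftRes_isResolventAt : IsResolventAt A ((specMin A - 1 : ℝ) : ℂ) (shiftRes A) := by
  refine isResolventAt_res ?_
  by_contra h
  have := specMin_le hA hbelow h
  linarith

lemma shiftRes_isSelfAdjoint : IsSelfAdjoint (shiftRes A) :=
  (shiftRes_isResolventAt hA hbelow).isSelfAdjoint hA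

lemma unshift_mem_spec {τ : ℝ} (hτ : τ ∈ spectrum ℝ (shiftRes A)) (hτ0 : τ ≠ 0) :
    ((unshift A τ : ℝ) : ℂ) ∈ spec A := fun h =>
  (shiftRes_isResolventAt hA hbelow).notMem_spectrum hτ0 h hτ

lemma spectrum_shiftRes_subset : spectrum ℝ (shiftRes A) ⊆ Icc 0 1 := by
  intro τ hτ
  by_cases hτ0 : τ = 0
  · simp [hτ0]
  have h := specMin_le hA hbelow (unshift_mem_spec hA hbelow hτ hτ0)
  have h1 : 1 ≤ τ⁻¹ := by unfold unshift at h; linarith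
  have h2 : 0 < τ := inv_pos.1 (by linarith)
  exact ⟨h2.le, (one_le_inv₀ h2).1 h1⟩

lemma shiftRes_nonneg : 0 ≤ shiftRes A :=
  (StarOrderedRing.nonneg_iff_spectrum_nonneg (R := ℝ) _ (shiftRes_isSelfAdjoint hA hbelow)).2
    fun _ hx => (spectrum_shiftRes_subset hA hbelow hx).1

lemma norm_shiftRes_le : ‖shiftRes A‖ ≤ 1 := by
  rw [← cfc_id ℝ (shiftRes A) (shiftRes_isSelfAdjoint hA hbelow)]
  refine norm_cfc_le zero_le_one fun x hx => ?_
  have := spectrum_shiftRes_subset hA hbelow hx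
  rw [id, Real.norm_eq_abs, abs_of_nonneg this.1]
  exact this.2

lemma norm_shiftRes_apply_le (x : H) : ‖shiftRes A x‖ ≤ ‖x‖ := by
  simpa using (shiftRes A).le_of_opNorm_le (norm_shiftRes_le hA hbelow) x

lemma sqrtRes_sqrtRes (x : H) : sqrtRes A (sqrtRes A x) = shiftRes A x :=
  congr($(CFC.sqrt_mul_sqrt_self (shiftRes A) (shiftRes_nonneg hA hbelow)) x)

lemma norm_sqrtRes_apply_le (x : H) : ‖sqrtRes A x‖ ≤ ‖x‖ := by
  have h : ‖sqrtRes A‖ ≤ 1 := by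
    rw [sqrtRes, CFC.norm_sqrt _ (shiftRes_nonneg hA hbelow)]
    exact Real.sqrt_le_one.2 (norm_shiftRes_le hA hbelow)
  simpa using (sqrtRes A).le_of_opNorm_le h x

lemma sqrtRes_injective : Function.Injective (sqrtRes A) := by
  intro x y hxy
  apply (shiftRes_isResolventAt hA hbelow).injective
  rw [← sqrtRes_sqrtRes hA hbelow, hxy, sqrtRes_sqrtRes hA hbelow]

lemma norm_sqrtRes_sq (x : H) : inner ℂ (shiftRes A x) x = ((‖sqrtRes A x‖ ^ 2 : ℝ) : ℂ) := by
  rw [← sqrtRes_sqrtRes hA hbelow]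
  have := (sqrtRes_isSelfAdjoint A).isSymmetric (sqrtRes A x) x
  refine this.trans ?_
  change inner ℂ (sqrtRes A x) (sqrtRes A x) = _
  rw [inner_self_eq_norm_sq_to_K]
  simp

lemma sqrtRes_mem_eigSup {s : Set ℝ} {u : H} (hu : u ∈ eigSup (shiftRes A) s) :
    sqrtRes A u ∈ eigSup (shiftRes A) s := by
  have : eigSup (shiftRes A) s ≤
      (eigSup (shiftRes A) s).comap (sqrtRes A : H →ₗ[ℂ] H) := by
    refine iSup₂_le fun τ hτ y hy => ?_
    have hy' : shiftRes A y = (τ : ℂ) • y := Module.End.mem_eigenspace_iff.1 hy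
    refine mem_eigSup_of_eigen (T := shiftRes A) hτ ?_
    change shiftRes A (sqrtRes A y) = (τ : ℂ) • sqrtRes A y
    rw [← sqrtRes_sqrtRes hA hbelow (sqrtRes A y), sqrtRes_sqrtRes hA hbelow y, hy', map_smul]
  exact this hu

end Basic

end Shift

/-! ### The part of the spectrum in the given interval -/

section Window

variable [CompleteSpace H] {A : H →ₗ.[ℂ] H}

lemma mem_eigSpace_unshift_iff (hA : IsSelfAdjoint A)
    (hbelow : ∃ c : ℝ, ∀ u : A.domain, c * ‖(u : H)‖ ^ 2 ≤ (inner ℂ (A u) (u : H)).re)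
    {τ : ℝ} (hτ : τ ≠ 0) {x : H} :
    x ∈ eigSpace A (unshift A τ : ℝ) ↔ shiftRes A x = (τ : ℂ) • x :=
  (shiftRes_isResolventAt hA hbelow).mem_eigSpace_iff hτ

/-- Numbers `τ ∈ σ((A - m + 1)⁻¹)` that correspond to points of the discrete spectrum of `A` are
isolated. -/
lemma eventually_notMem_spectrum (hA : IsSelfAdjoint A)
    (hbelow : ∃ c : ℝ, ∀ u : A.domain, c * ‖(u : H)‖ ^ 2 ≤ (inner ℂ (A u) (u : H)).re)
    {τ : ℝ} (hτ : τ ≠ 0) (hd : ((unshift A τ : ℝ) : ℂ) ∈ discSpec A) :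
    ∀ᶠ x in 𝓝[≠] τ, x ∉ spectrum ℝ (shiftRes A) := by
  obtain ⟨⟨ε, hε, hball⟩, -⟩ := hd
  have hc : ContinuousAt (fun x : ℝ => ((unshift A x : ℝ) : ℂ)) τ := by
    unfold unshift
    exact Complex.continuous_ofReal.continuousAt.comp
      (continuousAt_const.add (continuousAt_inv₀ hτ))
  have h1 : ∀ᶠ x in 𝓝 τ, ((unshift A x : ℝ) : ℂ) ∈ Metric.ball ((unshift A τ : ℝ) : ℂ) ε :=
    hc.eventually (Metric.ball_mem_nhds _ hε)
  have h2 : ∀ᶠ x in 𝓝 τ, x ≠ 0 := eventually_ne_nhds hτ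
  rw [eventually_nhdsWithin_iff]
  filter_upwards [h1, h2] with x h1 h2 hx hxσ
  have h3 : ((unshift A x : ℝ) : ℂ) ∈ ({((unshift A τ : ℝ) : ℂ)} : Set ℂ) :=
    hball ▸ ⟨unshift_mem_spec hA hbelow hxσ h2, h1⟩
  have h4 : unshift A x = unshift A τ := Complex.ofReal_injective h3
  unfold unshift at h4
  exact hx (inv_injective (add_left_cancel h4))

/-- The interval `[a, b]` corresponds to an interval `[α, β]` for the operator `(A - m + 1)⁻¹`, in
which that operator has finitely many eigenvalues of finite multiplicity and no other spectrum. -/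
theorem exists_window (hA : IsSelfAdjoint A)
    (hbelow : ∃ c : ℝ, ∀ u : A.domain, c * ‖(u : H)‖ ^ 2 ≤ (inner ℂ (A u) (u : H)).re)
    {a b : ℝ} (hab : a < b) (ha : (a : ℂ) ∈ resSet A) (hb : (b : ℂ) ∈ resSet A)
    (hess : realPts (essSpec A) ∩ Icc a b = ∅)
    (hne : (realPts (spec A) ∩ Icc a b).Nonempty) :
    ∃ α β : ℝ, 0 < α ∧ α < β ∧ α ∉ spectrum ℝ (shiftRes A) ∧ β ∉ spectrum ℝ (shiftRes A) ∧
      (∀ τ ∈ Ioc (0 : ℝ) 1, τ ∈ Icc α β ↔ unshift A τ ∈ Icc a b) ∧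
      (spectrum ℝ (shiftRes A) ∩ Icc α β).Finite ∧
      FiniteDimensional ℂ (eigSup (shiftRes A) (Icc α β)) ∧
      eigSpan A (Icc a b) = eigSup (shiftRes A) (Icc α β) ∧
      realPts (spec A) ∩ Icc a b = unshift A '' (spectrum ℝ (shiftRes A) ∩ Icc α β) := by
  set z := specMin A - 1 with hz
  have hun : ∀ τ, unshift A τ = z + τ⁻¹ := fun τ => rfl
  have hσ := spectrum_shiftRes_subset hA hbelow
  have hbz : 1 ≤ b - z := by
    obtain ⟨μ, hμ, hμ'⟩ := hne
    have := specMin_le hA hbelow hμ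
    have := hμ'.2
    linarith
  have hmem : ∀ {μ : ℝ}, (μ : ℂ) ∈ spec A → μ ∈ Icc a b → (μ : ℂ) ∈ discSpec A := by
    intro μ h1 h2
    by_contra h3
    exact (hess ▸ (⟨⟨h1, h3⟩, h2⟩ : μ ∈ realPts (essSpec A) ∩ Icc a b) : μ ∈ (∅ : Set ℝ))
  -- the maximum with `1/2` handles intervals that reach to the left of `m - 1`
  set t := max (a - z) (1 / 2) with ht
  have ht0 : 0 < t := lt_max_of_lt_right (by norm_num)
  have htb : t < b - z := max_lt (by linarith) (by linarith)
  have hb0 : 0 < b - z := by linarith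
  have hiff : ∀ τ ∈ Ioc (0 : ℝ) 1, τ ∈ Icc (b - z)⁻¹ t⁻¹ ↔ unshift A τ ∈ Icc a b := by
    rintro τ ⟨h0, h1⟩
    have h2 : 1 ≤ τ⁻¹ := (one_le_inv₀ h0).2 h1
    rw [hun, mem_Icc, mem_Icc, inv_le_comm₀ hb0 h0, le_inv_comm₀ h0 ht0, ht, max_le_iff]
    constructor
    · rintro ⟨h3, h4, -⟩; constructor <;> linarith
    · rintro ⟨h3, h4⟩; refine ⟨?_, ?_, ?_⟩ <;> linarith
  have hpos : ∀ τ ∈ Icc (b - z)⁻¹ t⁻¹, 0 < τ := fun τ hτ => (inv_pos.2 hb0).trans_le hτ.1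
  have hα : (b - z)⁻¹ ∉ spectrum ℝ (shiftRes A) := fun h => by
    refine unshift_mem_spec hA hbelow h (inv_pos.2 hb0).ne' ?_
    rwa [hun, inv_inv, add_sub_cancel]
  have hβ : t⁻¹ ∉ spectrum ℝ (shiftRes A) := fun h => by
    rcases max_choice (a - z) (1 / 2) with h' | h'
    · refine unshift_mem_spec hA hbelow h (inv_pos.2 ht0).ne' ?_
      rwa [hun, inv_inv, ht, h', add_sub_cancel]
    · have := (hσ h).2
      rw [ht, h'] at this
      norm_num at this
  have hdisc : ∀ τ ∈ spectrum ℝ (shiftRes A) ∩ Icc (b - z)⁻¹ t⁻¹,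
      ((unshift A τ : ℝ) : ℂ) ∈ discSpec A := by
    rintro τ ⟨h1, h2⟩
    exact hmem (unshift_mem_spec hA hbelow h1 (hpos τ h2).ne')
      ((hiff τ ⟨hpos τ h2, (hσ h1).2⟩).1 h2)
  have hfin : (spectrum ℝ (shiftRes A) ∩ Icc (b - z)⁻¹ t⁻¹).Finite := by
    by_contra hinf
    obtain ⟨τ, hτ, hacc⟩ := Set.Infinite.exists_accPt_of_subset_isCompact hinf
      ((spectrum.isCompact (𝕜 := ℝ) (shiftRes A)).inter_right isClosed_Icc) subset_rfl
    rw [accPt_iff_frequently_nhdsNE] at hacc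
    refine hacc ?_
    filter_upwards [eventually_notMem_spectrum hA hbelow (hpos τ hτ.2).ne' (hdisc τ hτ)] with x hx
    exact fun h => hx h.1
  refine ⟨(b - z)⁻¹, t⁻¹, inv_pos.2 hb0, inv_strictAnti₀ ht0 htb, hα, hβ, hiff, hfin, ?_, ?_, ?_⟩
  · have hle : eigSup (shiftRes A) (Icc (b - z)⁻¹ t⁻¹) ≤
        ⨆ τ : hfin.toFinset, eigSpace A (unshift A τ : ℝ) := by
      refine iSup₂_le fun τ hτ y hy => ?_
      have hy' : shiftRes A y = (τ : ℂ) • y := Module.End.mem_eigenspace_iff.1 hy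
      by_cases hy0 : y = 0
      · simp [hy0]
      exact Submodule.mem_iSup_of_mem
        ⟨τ, hfin.mem_toFinset.2 ⟨mem_spectrum_of_eigen hy0 hy', hτ⟩⟩
        ((mem_eigSpace_unshift_iff hA hbelow (hpos τ hτ).ne').2 hy')
    have : ∀ τ : hfin.toFinset, FiniteDimensional ℂ (eigSpace A (unshift A τ : ℝ)) := fun τ =>
      (hdisc τ (hfin.mem_toFinset.1 τ.2)).2.2
    exact Submodule.finiteDimensional_of_le hle
  · apply le_antisymm
    · refine iSup₂_le fun μ hμ y hy => ?_
      by_cases hy0 : y = 0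
      · simp [hy0]
      have hspec : (μ : ℂ) ∈ spec A := by
        rintro ⟨R, hR⟩
        obtain ⟨h, h'⟩ := mem_eigSpace_iff.1 hy
        have := hR.2 ⟨y, h⟩
        rw [h'] at this
        simp only [sub_self, map_zero] at this
        exact hy0 this.symm
      have h1 : 1 ≤ μ - z := by have := specMin_le hA hbelow hspec; linarith
      have h2 : unshift A (μ - z)⁻¹ = μ := by rw [hun, inv_inv, add_sub_cancel]
      have h3 : (μ - z)⁻¹ ∈ Ioc (0 : ℝ) 1 := ⟨by positivity, inv_le_one_of_one_le₀ h1⟩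
      rw [← h2] at hμ hy
      exact mem_eigSup_of_eigen (s := Icc (b - z)⁻¹ t⁻¹) ((hiff _ h3).2 hμ)
        ((mem_eigSpace_unshift_iff hA hbelow h3.1.ne').1 hy)
    · refine iSup₂_le fun τ hτ y hy => ?_
      have hy' : shiftRes A y = (τ : ℂ) • y := Module.End.mem_eigenspace_iff.1 hy
      by_cases hy0 : y = 0
      · simp [hy0]
      have h1 := (hσ (mem_spectrum_of_eigen hy0 hy')).2
      exact Submodule.mem_iSup_of_mem (unshift A τ) <| Submodule.mem_iSup_of_mem
        ((hiff τ ⟨hpos τ hτ, h1⟩).1 hτ)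
        ((mem_eigSpace_unshift_iff hA hbelow (hpos τ hτ).ne').2 hy')
  · ext μ
    constructor
    · rintro ⟨h1, h2⟩
      have hd := hmem h1 h2
      obtain ⟨y, hy, hy0⟩ := Submodule.exists_mem_ne_zero_of_ne_bot hd.2.1
      have h3 : 1 ≤ μ - z := by have := specMin_le hA hbelow h1; linarith
      have h4 : unshift A (μ - z)⁻¹ = μ := by rw [hun, inv_inv, add_sub_cancel]
      have h5 : (μ - z)⁻¹ ∈ Ioc (0 : ℝ) 1 := ⟨by positivity, inv_le_one_of_one_le₀ h3⟩
      rw [← h4] at hy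
      exact ⟨(μ - z)⁻¹, ⟨mem_spectrum_of_eigen hy0
        ((mem_eigSpace_unshift_iff hA hbelow h5.1.ne').1 hy),
        (hiff _ h5).2 (by rw [h4]; exact h2)⟩, h4⟩
    · rintro ⟨τ, ⟨h1, h2⟩, rfl⟩
      exact ⟨unshift_mem_spec hA hbelow h1 (hpos τ h2).ne',
        (hiff τ ⟨hpos τ h2, (hσ h1).2⟩).1 h2⟩

end Window

/-! ### The Galerkin method in terms of the square root of the resolvent -/

section Galerkin

variable [CompleteSpace H] {A : H →ₗ.[ℂ] H}

lemma mem_formDom_iff {u : H} : u ∈ formDom A ↔ ∃ x, sqrtRes A x = u := by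
  change u ∈ (LinearPMap.inverse ((sqrtRes A).toLinearMap.toPMap ⊤)).domain ↔ _
  rw [LinearPMap.inverse_domain]
  constructor
  · rintro ⟨x, rfl⟩; exact ⟨x, rfl⟩
  · rintro ⟨x, rfl⟩; exact ⟨⟨x, trivial⟩, rfl⟩

lemma sqrtRes_mem_formDom (A : H →ₗ.[ℂ] H) (x : H) : sqrtRes A x ∈ formDom A :=
  (mem_formDom_iff).2 ⟨x, rfl⟩

section

variable (hA : IsSelfAdjoint A)
  (hbelow : ∃ c : ℝ, ∀ u : A.domain, c * ‖(u : H)‖ ^ 2 ≤ (inner ℂ (A u) (u : H)).re)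
include hA hbelow

lemma ker_toPMap_sqrtRes :
    LinearMap.ker ((sqrtRes A).toLinearMap.toPMap ⊤).toFun = ⊥ := by
  rw [LinearMap.ker_eq_bot']
  intro u hu
  apply Subtype.ext
  apply sqrtRes_injective hA hbelow
  rw [show (((0 : _) : ((sqrtRes A).toLinearMap.toPMap ⊤).domain) : H) = 0 from rfl, map_zero]
  exact hu

lemma sqrtShift_apply {u : formDom A} {x : H} (hx : sqrtRes A x = u) : sqrtShift A u = x :=
  LinearPMap.inverse_apply_eq (ker_toPMap_sqrtRes hA hbelow)
    (x := (⟨x, trivial⟩ : ((sqrtRes A).toLinearMap.toPMap ⊤).domain)) hx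

lemma form_apply {u v : formDom A} {x y : H} (hx : sqrtRes A x = u) (hy : sqrtRes A y = v) :
    form A u v = inner ℂ x y + ((specMin A - 1 : ℝ) : ℂ) * inner ℂ (u : H) (v : H) := by
  rw [form, sqrtShift_apply hA hbelow hx, sqrtShift_apply hA hbelow hy]

lemma formNorm_apply {u : formDom A} {x : H} (hx : sqrtRes A x = u) : formNorm A u = ‖x‖ := by
  rw [formNorm, form_apply hA hbelow hx hx, inner_self_eq_norm_sq_to_K, inner_self_eq_norm_sq_to_K]
  have : (((‖x‖ : ℝ) : ℂ) ^ 2 + ((specMin A - 1 : ℝ) : ℂ) * ((‖(u : H)‖ : ℝ) : ℂ) ^ 2).re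
      = ‖x‖ ^ 2 + (specMin A - 1) * ‖(u : H)‖ ^ 2 := by
    rw [← Complex.ofReal_pow, ← Complex.ofReal_pow, ← Complex.ofReal_mul, ← Complex.ofReal_add,
      Complex.ofReal_re]
  refine (congr_arg (fun r : ℝ => √(r - (specMin A - 1) * ‖(u : H)‖ ^ 2)) this).trans ?_
  rw [add_sub_cancel_right, Real.sqrt_sq (norm_nonneg _)]

/-- In terms of `x = (A - m + 1)^{1/2} u`, the Galerkin eigenvalue problem is the one for the
compression of `(A - m + 1)⁻¹` to the preimage of the trial space. -/
lemma isGalerkinSol_iff {M : Submodule ℂ H}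
    [(M.comap (sqrtRes A : H →ₗ[ℂ] H)).HasOrthogonalProjection] {u : formDom A} {x : H}
    (hx : sqrtRes A x = u) (hx0 : x ≠ 0) {μ : ℝ} :
    IsGalerkinSol A M μ u ↔ ∃ τ ∈ Ioc (0 : ℝ) 1, unshift A τ = μ ∧
      x ∈ M.comap (sqrtRes A : H →ₗ[ℂ] H) ∧
      (M.comap (sqrtRes A : H →ₗ[ℂ] H)).starProjection (shiftRes A x) = (τ : ℂ) • x := by
  set K := M.comap (sqrtRes A : H →ₗ[ℂ] H) with hK
  set z := specMin A - 1 with hz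
  have hn : 0 < ‖x‖ := norm_pos_iff.2 hx0
  have hform : ∀ y, form A u ⟨sqrtRes A y, sqrtRes_mem_formDom A y⟩
      = (μ : ℂ) * inner ℂ (u : H) (sqrtRes A y) ↔
      inner ℂ (x - ((μ - z : ℝ) : ℂ) • shiftRes A x) y = 0 := by
    intro y
    have h1 : inner ℂ (u : H) (sqrtRes A y) = inner ℂ (shiftRes A x) y := by
      rw [← hx, ← sqrtRes_sqrtRes hA hbelow]
      exact ((sqrtRes_isSelfAdjoint A).isSymmetric (sqrtRes A x) y).symm
    rw [form_apply hA hbelow hx (y := y) rfl, h1, inner_sub_left, inner_smul_left,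
      Complex.conj_ofReal, sub_eq_zero, Complex.ofReal_sub μ z, sub_mul (μ : ℂ), eq_sub_iff_add_eq]
  have hsol : IsGalerkinSol A M μ u ↔
      x ∈ K ∧ x = ((μ - z : ℝ) : ℂ) • K.starProjection (shiftRes A x) := by
    constructor
    · rintro ⟨h1, h2⟩
      have hxK : x ∈ K := by
        change sqrtRes A x ∈ M
        rwa [hx]
      refine ⟨hxK, ?_⟩
      have h3 : K.starProjection (((μ - z : ℝ) : ℂ) • shiftRes A x) = x := by
        refine Submodule.eq_starProjection_of_mem_of_inner_eq_zero hxK fun y hy => ?_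
        rw [← neg_sub, inner_neg_left, (hform y).1 (h2 _ hy), neg_zero]
      rw [map_smul] at h3
      exact h3.symm
    · rintro ⟨hxK, h⟩
      refine ⟨?_, ?_⟩
      · rw [← hx]; exact hxK
      · rintro ⟨v, hv⟩ hvM
        obtain ⟨y, rfl⟩ := (mem_formDom_iff).1 hv
        have hyK : y ∈ K := hvM
        refine (hform y).2 ?_
        have h4 := Submodule.starProjection_inner_eq_zero
          (K := K) (((μ - z : ℝ) : ℂ) • shiftRes A x) y hyK
        rw [map_smul, ← h] at h4
        rw [← neg_sub, inner_neg_left, h4, neg_zero]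
  rw [hsol]
  constructor
  · rintro ⟨hxK, h⟩
    set t := μ - z with ht
    have h1 : ‖x‖ ^ 2 = t * ‖sqrtRes A x‖ ^ 2 := by
      have e : inner ℂ x x = (t : ℂ) * inner ℂ (shiftRes A x) x := by
        conv_lhs => rw [h]
        rw [inner_smul_left, Complex.conj_ofReal]
        conv_lhs => rw [Submodule.inner_starProjection_left_eq_right, ← h]
        rw [Submodule.starProjection_eq_self_iff.2 hxK]
      rw [norm_sqrtRes_sq hA hbelow, inner_self_eq_norm_sq_to_K] at e
      apply Complex.ofReal_injective
      push_cast at e ⊢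
      exact e
    have h2 : ‖sqrtRes A x‖ ^ 2 ≤ ‖x‖ ^ 2 := by
      gcongr; exact norm_sqrtRes_apply_le hA hbelow x
    have h3 : 1 ≤ t := by
      by_contra! h'
      have : 0 ≤ ‖sqrtRes A x‖ ^ 2 := by positivity
      have : 0 < ‖x‖ ^ 2 := by positivity
      by_cases ht0 : t ≤ 0
      · nlinarith
      · nlinarith
    have ht0 : (t : ℂ) ≠ 0 := by
      have : t ≠ 0 := by linarith
      exact_mod_cast this
    refine ⟨t⁻¹, ⟨by positivity, inv_le_one_of_one_le₀ h3⟩, ?_, hxK, ?_⟩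
    · change z + t⁻¹⁻¹ = μ
      rw [inv_inv, ht, add_sub_cancel]
    · conv_rhs => rw [h]
      rw [smul_smul, Complex.ofReal_inv, inv_mul_cancel₀ ht0, one_smul]
  · rintro ⟨τ, hτ, rfl, hxK, h⟩
    refine ⟨hxK, ?_⟩
    have : unshift A τ - z = τ⁻¹ := by
      change z + τ⁻¹ - z = τ⁻¹
      ring
    have hτ0 : (τ : ℂ) ≠ 0 := by exact_mod_cast hτ.1.ne'
    rw [this, h, smul_smul, Complex.ofReal_inv, inv_mul_cancel₀ hτ0, one_smul]

lemma mem_galerkinSpec_iff {M : Submodule ℂ H}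
    [(M.comap (sqrtRes A : H →ₗ[ℂ] H)).HasOrthogonalProjection] {μ : ℝ} :
    μ ∈ galerkinSpec A M ↔ ∃ τ ∈ Ioc (0 : ℝ) 1, unshift A τ = μ ∧
      ∃ x ∈ M.comap (sqrtRes A : H →ₗ[ℂ] H), x ≠ 0 ∧
      (M.comap (sqrtRes A : H →ₗ[ℂ] H)).starProjection (shiftRes A x) = (τ : ℂ) • x := by
  constructor
  · rintro ⟨u, hu0, hu⟩
    obtain ⟨x, hx⟩ := (mem_formDom_iff).1 u.2
    have hx0 : x ≠ 0 := by
      rintro rfl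
      rw [map_zero] at hx
      exact hu0 (Subtype.ext hx.symm)
    obtain ⟨τ, h1, h2, h3, h4⟩ := (isGalerkinSol_iff hA hbelow hx hx0).1 hu
    exact ⟨τ, h1, h2, x, h3, hx0, h4⟩
  · rintro ⟨τ, h1, h2, x, h3, hx0, h4⟩
    refine ⟨⟨sqrtRes A x, sqrtRes_mem_formDom A x⟩, fun h => hx0 ?_,
      (isGalerkinSol_iff hA hbelow rfl hx0).2 ⟨τ, h1, h2, h3, h4⟩⟩
    have := congr_arg Subtype.val h
    exact sqrtRes_injective hA hbelow (by rw [map_zero]; exact this)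

/-- The Galerkin spectral subspace is the image of a spectral subspace of a compression. -/
lemma galerkinSpan_eq {M : Submodule ℂ H}
    [(M.comap (sqrtRes A : H →ₗ[ℂ] H)).HasOrthogonalProjection] {a b α β : ℝ} (hα : 0 < α)
    (hiff : ∀ τ ∈ Ioc (0 : ℝ) 1, τ ∈ Icc α β ↔ unshift A τ ∈ Icc a b) :
    galerkinSpan A M (Icc a b) =
      (eigSup ((M.comap (sqrtRes A : H →ₗ[ℂ] H)).starProjection * shiftRes A *
        (M.comap (sqrtRes A : H →ₗ[ℂ] H)).starProjection) (Icc α β)).map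
          (sqrtRes A : H →ₗ[ℂ] H) := by
  set K := M.comap (sqrtRes A : H →ₗ[ℂ] H) with hK
  set B := K.starProjection * shiftRes A * K.starProjection with hB
  have hBa : ∀ x, B x = K.starProjection (shiftRes A (K.starProjection x)) := fun _ => rfl
  apply le_antisymm
  · refine Submodule.span_le.2 ?_
    rintro _ ⟨u, ⟨μ, hμ, hu⟩, rfl⟩
    obtain ⟨x, hx⟩ := (mem_formDom_iff).1 u.2
    refine ⟨x, ?_, hx⟩
    by_cases hx0 : x = 0
    · rw [hx0]; exact zero_mem _
    obtain ⟨τ, h1, rfl, h3, h4⟩ := (isGalerkinSol_iff hA hbelow hx hx0).1 hu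
    refine mem_eigSup_of_eigen ((hiff τ h1).2 hμ) ?_
    rw [hBa, Submodule.starProjection_eq_self_iff.2 h3, h4]
  · rw [Submodule.map_le_iff_le_comap]
    refine iSup₂_le fun τ hτ x hx => ?_
    by_cases hx0 : x = 0
    · rw [hx0]; exact zero_mem _
    have hx' : B x = (τ : ℂ) • x := Module.End.mem_eigenspace_iff.1 hx
    have hτ0 : 0 < τ := hα.trans_le hτ.1
    have hτ0' : (τ : ℂ) ≠ 0 := by exact_mod_cast hτ0.ne'
    have hτ1 : τ ≤ 1 := by
      have hn : 0 < ‖x‖ := norm_pos_iff.2 hx0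
      have h1 : ‖B x‖ ≤ ‖x‖ := (Submodule.norm_starProjection_apply_le _ _).trans
        ((norm_shiftRes_apply_le hA hbelow _).trans (Submodule.norm_starProjection_apply_le _ _))
      rw [hx', norm_smul, Complex.norm_real, Real.norm_eq_abs, abs_of_pos hτ0] at h1
      by_contra! h'
      nlinarith
    have hxK : x ∈ K := by
      have : x = (τ : ℂ)⁻¹ • B x := by
        rw [hx', smul_smul, inv_mul_cancel₀ hτ0', one_smul]
      rw [this]
      exact K.smul_mem _ (Submodule.starProjection_apply_mem _ _)
    refine Submodule.subset_span ⟨⟨sqrtRes A x, sqrtRes_mem_formDom A x⟩,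
      ⟨unshift A τ, (hiff τ ⟨hτ0, hτ1⟩).1 hτ, ?_⟩, rfl⟩
    refine (isGalerkinSol_iff hA hbelow rfl hx0).2 ⟨τ, ⟨hτ0, hτ1⟩, rfl, hxK, ?_⟩
    rwa [hBa, Submodule.starProjection_eq_self_iff.2 hxK] at hx'

end

end Galerkin

/-! ### Gaps, compressed projections and filtered spaces -/

section Gap

variable {V : Type*} [AddCommGroup V] [Module ℂ V] {N : V → ℝ}

lemma gap_nonneg (hN : ∀ x, 0 ≤ N x) (K M : Submodule ℂ V) : 0 ≤ gap N K M := by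
  refine Real.sSup_nonneg ?_
  rintro _ ⟨u, -, -, rfl⟩
  exact Real.iInf_nonneg fun v => hN _

lemma gap_le (hN : ∀ x, 0 ≤ N x) {K M : Submodule ℂ V} {ε : ℝ} (hε : 0 ≤ ε)
    (h : ∀ u ∈ K, ∃ v ∈ M, N (u - v) ≤ ε * N u) : gap N K M ≤ ε := by
  refine Real.sSup_le ?_ hε
  rintro _ ⟨u, hu, hu1, rfl⟩
  obtain ⟨v, hv, hv'⟩ := h u hu
  rw [hu1, mul_one] at hv'
  exact ciInf_le_of_le ⟨0, by rintro _ ⟨w, rfl⟩; exact hN _⟩ (⟨v, hv⟩ : M) hv'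

lemma tendsto_symGap (hN : ∀ x, 0 ≤ N x) {K : ℕ → Submodule ℂ V} {M : Submodule ℂ V}
    (h : ∀ ε > 0, ∀ᶠ n in atTop, (∀ u ∈ K n, ∃ v ∈ M, N (u - v) ≤ ε * N u) ∧
      ∀ u ∈ M, ∃ v ∈ K n, N (u - v) ≤ ε * N u) :
    Tendsto (fun n => symGap N (K n) M) atTop (𝓝 0) := by
  rw [Metric.tendsto_nhds]
  intro ε hε
  filter_upwards [h (ε / 2) (by positivity)] with n ⟨h1, h2⟩
  have h0 : 0 ≤ symGap N (K n) M := (gap_nonneg hN _ _).trans (le_max_left _ _)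
  rw [Real.dist_eq, sub_zero, abs_of_nonneg h0]
  exact (max_le (gap_le hN (by positivity) h1) (gap_le hN (by positivity) h2)).trans_lt
    (by linarith)

end Gap

section Compressed

lemma mem_spec_toPMap_iff (T : H →L[ℂ] H) (z : ℂ) :
    z ∈ spec (T.toLinearMap.toPMap ⊤) ↔ z ∈ spectrum ℂ T := by
  refine not_congr ?_
  rw [spectrum.mem_resolventSet_iff]
  have ha : ∀ x, (algebraMap ℂ (H →L[ℂ] H) z - T) x = z • x - T x := fun _ => rfl
  constructor
  · rintro ⟨R, h1, h2⟩
    have h1' : ∀ x, T (R x) - z • R x = x := fun x => (h1 x).2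
    have h2' : ∀ x, R (T x - z • x) = x := fun x => h2 ⟨x, trivial⟩
    refine ⟨⟨algebraMap ℂ (H →L[ℂ] H) z - T, -R, ?_, ?_⟩, rfl⟩
    · ext x
      change (algebraMap ℂ (H →L[ℂ] H) z - T) (-(R x)) = x
      rw [map_neg, ha, neg_sub, h1']
    · ext x
      change -(R ((algebraMap ℂ (H →L[ℂ] H) z - T) x)) = x
      rw [ha, ← map_neg, neg_sub, h2']
  · rintro ⟨v, hv⟩
    have h1 : ∀ x, (v : H →L[ℂ] H) ((↑v⁻¹ : H →L[ℂ] H) x) = x := fun x => congr($(v.mul_inv) x)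
    have h2 : ∀ x, (↑v⁻¹ : H →L[ℂ] H) ((v : H →L[ℂ] H) x) = x := fun x => congr($(v.inv_mul) x)
    rw [hv] at h1 h2
    refine ⟨-(↑v⁻¹ : H →L[ℂ] H), fun x => ⟨trivial, ?_⟩, fun u => ?_⟩
    · change T (-((↑v⁻¹ : H →L[ℂ] H) x)) - z • (-((↑v⁻¹ : H →L[ℂ] H) x)) = x
      have := h1 x
      rw [ha] at this
      rw [map_neg, smul_neg, sub_neg_eq_add, neg_add_eq_sub, this]
    · change -((↑v⁻¹ : H →L[ℂ] H) (T u - z • (u : H))) = u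
      rw [← map_neg, neg_sub, ← ha, h2]

variable [CompleteSpace H]

/-- Away from `0`, the discrete spectrum of `E P E` is its spectrum. -/
lemma discSpec_compressedProj (A : H →ₗ.[ℂ] H) (I : Set ℝ) (L : Submodule ℂ H)
    [FiniteDimensional ℂ (eigSpan A I)] [FiniteDimensional ℂ L] :
    realPts (discSpec (compressedProj A I L)) \ {0}
      = spectrum ℝ (filterOp (eigSpan A I) L) \ {0} := by
  set E := eigSpan A I with hE
  set T := filterOp E L with hT
  have hTA : compressedProj A I L = T.toLinearMap.toPMap ⊤ := by
    rw [compressedProj, orthProj_eq, orthProj_eq]; rfl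
  have hfin : (spectrum ℂ T).Finite := finite_spectrum_of_range_le E (filterOp_mem E L)
  have hspec : spec (T.toLinearMap.toPMap ⊤) = spectrum ℂ T :=
    Set.ext fun z => mem_spec_toPMap_iff T z
  ext τ
  refine and_congr_left fun hτ0 => ?_
  have hτ0' : τ ≠ 0 := hτ0
  rw [hTA, ← spectrum.algebraMap_mem_iff ℂ]
  change (τ : ℂ) ∈ discSpec _ ↔ (τ : ℂ) ∈ spectrum ℂ T
  constructor
  · rintro ⟨⟨ε, hε, h⟩, -⟩
    have : (τ : ℂ) ∈ spec (T.toLinearMap.toPMap ⊤) ∩ Metric.ball (τ : ℂ) ε := by rw [h]; rfl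
    exact hspec ▸ this.1
  · intro hτ
    refine ⟨?_, ?_, ?_⟩
    · have hcl : IsClosed (spectrum ℂ T \ {(τ : ℂ)}) := (hfin.subset sdiff_subset).isClosed
      obtain ⟨ε, hε, hball⟩ := Metric.mem_nhds_iff.1
        (hcl.isOpen_compl.mem_nhds (fun h => h.2 rfl : (τ : ℂ) ∉ spectrum ℂ T \ {(τ : ℂ)}))
      refine ⟨ε, hε, ?_⟩
      rw [hspec]
      ext z
      constructor
      · rintro ⟨h1, h2⟩
        by_contra h3
        exact hball h2 ⟨h1, h3⟩
      · rintro rfl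
        exact ⟨hτ, Metric.mem_ball_self hε⟩
    · obtain ⟨x, hx0, hx⟩ := filterOp_exists_eigenvector (E := E) (L := L) (τ := τ)
        ((spectrum.algebraMap_mem_iff ℂ).1 hτ)
      refine (Submodule.ne_bot_iff _).2 ⟨x, ?_, hx0⟩
      exact mem_eigSpace_iff.2 ⟨trivial, hx⟩
    · refine Submodule.finiteDimensional_of_le (S₂ := E) fun x hx => ?_
      obtain ⟨_, hx'⟩ := mem_eigSpace_iff.1 hx
      exact mem_of_filterOp_eigen (L := L) hτ0' hx'

/-- For non-zero eigenvalues, restricting `Q P` to the range `G` of `Q` is the same as passing to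
`Q P Q`. -/
lemma eigSpan_restrict_eq (G L : Submodule ℂ H) [FiniteDimensional ℂ G] [FiniteDimensional ℂ L]
    {s : Set ℝ} (hs : (0 : ℝ) ∉ s) :
    eigSpan ((orthProj G ∘L orthProj L).toLinearMap.toPMap G) s = eigSup (filterOp G L) s := by
  rw [orthProj_eq, orthProj_eq]
  unfold eigSpan eigSup
  refine iSup_congr fun τ => iSup_congr fun hτ => ?_
  ext x
  rw [mem_eigSpace_iff, Module.End.mem_eigenspace_iff]
  change (∃ _ : x ∈ G, G.starProjection (L.starProjection x) = (τ : ℂ) • x) ↔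
    filterOp G L x = (τ : ℂ) • x
  constructor
  · rintro ⟨h, hx⟩
    rwa [filterOp_apply, Submodule.starProjection_eq_self_iff.2 h]
  · intro hx
    have h := mem_of_filterOp_eigen (L := L) (fun h0 => hs (h0 ▸ hτ)) hx
    refine ⟨h, ?_⟩
    rwa [filterOp_apply, Submodule.starProjection_eq_self_iff.2 h] at hx

end Compressed

/-! ### Convergence of the filtered Galerkin method -/

section Main

lemma finiteDimensional_comap {S : H →L[ℂ] H} (hS : Function.Injective S) (M : Submodule ℂ H)
    [FiniteDimensional ℂ M] : FiniteDimensional ℂ (M.comap (S : H →ₗ[ℂ] H)) :=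
  Module.Finite.of_injective
    ((S : H →ₗ[ℂ] H).restrict (p := M.comap (S : H →ₗ[ℂ] H)) (q := M) fun _ hx => hx)
    fun _ _ hxy => Subtype.ext (hS (congr_arg Subtype.val hxy))

lemma starProjection_comap_tendsto [CompleteSpace H] {A : H →ₗ.[ℂ] H} (hA : IsSelfAdjoint A)
    (hbelow : ∃ c : ℝ, ∀ u : A.domain, c * ‖(u : H)‖ ^ 2 ≤ (inner ℂ (A u) (u : H)).re)
    {L : ℕ → Submodule ℂ H}
    [∀ n, ((L n).comap (sqrtRes A : H →ₗ[ℂ] H)).HasOrthogonalProjection]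
    (happrox : ∀ u : formDom A, ∃ v : ℕ → formDom A, (∀ n, (v n : H) ∈ L n) ∧
      Tendsto (fun n => formNorm A (u - v n)) atTop (𝓝 0)) (x : H) :
    Tendsto (fun n => ((L n).comap (sqrtRes A : H →ₗ[ℂ] H)).starProjection x) atTop (𝓝 x) := by
  obtain ⟨v, hv, hlim⟩ := happrox ⟨sqrtRes A x, sqrtRes_mem_formDom A x⟩
  choose y hy using fun n => mem_formDom_iff.1 (v n).2
  have hnorm : ∀ n, formNorm A (⟨sqrtRes A x, sqrtRes_mem_formDom A x⟩ - v n) = ‖x - y n‖ :=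
    fun n => formNorm_apply hA hbelow (by
      rw [map_sub, hy]; rfl)
  simp only [hnorm] at hlim
  rw [tendsto_iff_norm_sub_tendsto_zero]
  refine squeeze_zero (fun _ => norm_nonneg _) (fun n => ?_) hlim
  rw [norm_sub_rev]
  refine norm_sub_starProjection_le _ _ ?_
  change sqrtRes A (y n) ∈ L n
  rw [hy]; exact hv n

/-- On numbers `≥ α`, the map `τ ↦ m - 1 + τ⁻¹` is Lipschitz with constant `α⁻²`. -/
lemma edist_unshift_le (A : H →ₗ.[ℂ] H) {α ε σ τ : ℝ} (hα : 0 < α) (hσ : α ≤ σ) (hτ : α ≤ τ)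
    (h : |σ - τ| ≤ ε * α ^ 2) : edist (unshift A σ) (unshift A τ) ≤ ENNReal.ofReal ε := by
  rw [edist_dist]
  refine ENNReal.ofReal_le_ofReal ?_
  have hσ0 := hα.trans_le hσ
  have hτ0 := hα.trans_le hτ
  have e : unshift A σ - unshift A τ = (τ - σ) / (σ * τ) := by
    unfold unshift; field_simp; ring
  rw [Real.dist_eq, e, abs_div, abs_of_pos (mul_pos hσ0 hτ0), abs_sub_comm,
    div_le_iff₀ (mul_pos hσ0 hτ0)]
  have hε : 0 ≤ ε := by
    by_contra! h'
    have : ε * α ^ 2 < 0 := mul_neg_of_neg_of_pos h' (by positivity)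
    linarith [abs_nonneg (σ - τ)]
  refine h.trans ?_
  rw [sq]
  gcongr

variable [CompleteSpace H] {A : H →ₗ.[ℂ] H}

/-- The form norm of `u` is the norm of `(A - m + 1)^{1/2} u`, so closeness in the form norm is
closeness of the preimages under `(A - m + 1)^{-1/2}`. -/
lemma tendsto_formSymGap (hA : IsSelfAdjoint A)
    (hbelow : ∃ c : ℝ, ∀ u : A.domain, c * ‖(u : H)‖ ^ 2 ≤ (inner ℂ (A u) (u : H)).re)
    {E : Submodule ℂ H} (hSE : ∀ u ∈ E, sqrtRes A u ∈ E) (hES : ∀ u ∈ E, ∃ x ∈ E, sqrtRes A x = u)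
    {M : ℕ → Submodule ℂ H}
    (hclose : ∀ ε > 0, ∀ᶠ n in atTop,
      SubClose ((M n).comap (sqrtRes A : H →ₗ[ℂ] H)) E ε ∧
      SubClose E ((M n).comap (sqrtRes A : H →ₗ[ℂ] H)) ε) :
    Tendsto (fun n => formSymGap A (M n) E) atTop (𝓝 0) := by
  refine tendsto_symGap (N := formNorm A) (fun u => Real.sqrt_nonneg _) fun ε hε => ?_
  filter_upwards [hclose ε hε] with n ⟨h1, h2⟩
  have hsub : ∀ (u : formDom A) (x y : H), sqrtRes A x = u →
      formNorm A (u - ⟨sqrtRes A y, sqrtRes_mem_formDom A y⟩) = ‖x - y‖ := fun u x y hx =>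
    formNorm_apply hA hbelow (by rw [map_sub]; exact congr_arg (· - sqrtRes A y) hx)
  constructor
  · intro u hu
    obtain ⟨x, hx⟩ := mem_formDom_iff.1 u.2
    have hxM : x ∈ (M n).comap (sqrtRes A : H →ₗ[ℂ] H) := by
      change sqrtRes A x ∈ M n
      rw [hx]; exact hu
    obtain ⟨y, hy, hxy⟩ := h1 x hxM
    refine ⟨⟨sqrtRes A y, sqrtRes_mem_formDom A y⟩, hSE y hy, ?_⟩
    rwa [hsub u x y hx, formNorm_apply hA hbelow hx]
  · intro u hu
    obtain ⟨x, hxE, hx⟩ := hES u hu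
    obtain ⟨y, hy, hxy⟩ := h2 x hxE
    refine ⟨⟨sqrtRes A y, sqrtRes_mem_formDom A y⟩, hy, ?_⟩
    rwa [hsub u x y hx, formNorm_apply hA hbelow hx]

/-- Galerkin eigenvalues in subspaces that approximate a spectral subspace of `A` in the form norm
converge to the corresponding part of the spectrum. -/
lemma tendsto_hausdorffEDist_galerkinSpec (hA : IsSelfAdjoint A)
    (hbelow : ∃ c : ℝ, ∀ u : A.domain, c * ‖(u : H)‖ ^ 2 ≤ (inner ℂ (A u) (u : H)).re)
    {α β : ℝ} (hα : 0 < α) (hασ : α ∉ spectrum ℝ (shiftRes A)) (hβσ : β ∉ spectrum ℝ (shiftRes A))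
    (hσfin : (spectrum ℝ (shiftRes A) ∩ Icc α β).Finite)
    {M : ℕ → Submodule ℂ H} [∀ n, FiniteDimensional ℂ (M n)]
    (hlow : ∀ n, ∀ x ∈ (M n).comap (sqrtRes A : H →ₗ[ℂ] H), α * ‖x‖ ^ 2 ≤ ‖sqrtRes A x‖ ^ 2)
    (hclose : ∀ ε > 0, ∀ᶠ n in atTop,
      SubClose ((M n).comap (sqrtRes A : H →ₗ[ℂ] H)) (eigSup (shiftRes A) (Icc α β)) ε ∧
      SubClose (eigSup (shiftRes A) (Icc α β)) ((M n).comap (sqrtRes A : H →ₗ[ℂ] H)) ε) :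
    Tendsto (fun n => Metric.hausdorffEDist (galerkinSpec A (M n))
      (unshift A '' (spectrum ℝ (shiftRes A) ∩ Icc α β))) atTop (𝓝 0) := by
  set R := shiftRes A with hR
  have hRsa : IsSelfAdjoint R := shiftRes_isSelfAdjoint hA hbelow
  have hR1 : ∀ x, ‖R x‖ ≤ ‖x‖ := norm_shiftRes_apply_le hA hbelow
  have hsep : Separated R (Icc α β) := separated_Icc hασ hβσ
  set E := eigSup R (Icc α β) with hE
  have hmemE : ∀ {x}, specProj R (Icc α β) x = x ↔ x ∈ E := specProj_eq_self_iff hRsa hsep hσfin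
  have hRE : ∀ u ∈ E, R u ∈ E := fun u hu => by
    rw [← hmemE, specProj_comm_apply hRsa, hmemE.2 hu]
  set M' : ℕ → Submodule ℂ H := fun n => (M n).comap (sqrtRes A : H →ₗ[ℂ] H) with hM'
  have hM'fin : ∀ n, FiniteDimensional ℂ (M' n) := fun n =>
    finiteDimensional_comap (sqrtRes_injective hA hbelow) (M n)
  have hritz : ∀ n (τ : ℝ) (x : H), x ∈ M' n → x ≠ 0 →
      (M' n).starProjection (R x) = (τ : ℂ) • x → α ≤ τ := by
    intro n τ x hx hx0 hτ
    have h1 := hlow n x hx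
    have h2 : inner ℂ (R x) x = ((τ * ‖x‖ ^ 2 : ℝ) : ℂ) := by
      have h3 : inner ℂ (R x) x = inner ℂ ((M' n).starProjection (R x)) x := by
        rw [Submodule.inner_starProjection_left_eq_right, Submodule.starProjection_eq_self_iff.2 hx]
      rw [h3, hτ, inner_smul_left, Complex.conj_ofReal, inner_self_eq_norm_sq_to_K]
      simp
    rw [norm_sqrtRes_sq hA hbelow] at h2
    rw [Complex.ofReal_injective h2] at h1
    exact le_of_mul_le_mul_right h1 (pow_pos (norm_pos_iff.2 hx0) 2)
  rw [ENNReal.tendsto_nhds_zero]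
  intro ε hε
  obtain ⟨r, hr0, hrε⟩ := ENNReal.lt_iff_exists_nnreal_btwn.1 hε
  have hr : (0 : ℝ) < r := by exact_mod_cast hr0
  have hrε' : ENNReal.ofReal r ≤ ε := by rw [ENNReal.ofReal_coe_nnreal]; exact hrε.le
  -- `|σ - τ| < δ` gives `|σ⁻¹ - τ⁻¹| ≤ r` for `σ, τ ≥ α`
  set δ : ℝ := min (min 1 α) (r * α ^ 2) with hδ
  have hδ0 : 0 < δ := by positivity
  have hδ1 : δ ≤ 1 := (min_le_left _ _).trans (min_le_left _ _)
  have hδα : δ ≤ α := (min_le_left _ _).trans (min_le_right _ _)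
  have hδr : δ ≤ r * α ^ 2 := min_le_right _ _
  filter_upwards [hclose (δ / 10) (by positivity)] with n ⟨h1, h2⟩
  refine (Metric.hausdorffEDist_le_of_mem_edist ?_ ?_).trans hrε'
  · intro μ hμ
    obtain ⟨τ, -, rfl, x, hxM, hx0, hx⟩ := (mem_galerkinSpec_iff hA hbelow).1 hμ
    obtain ⟨σ, hσ, hστ⟩ := exists_spectrum_near_ritz hRsa hR1 hsep
      (fun y hy => hmemE.2 hy) hRE h1 h2 (by positivity) hδ0 hδ1 (by linarith) hxM hx0 hx
    refine ⟨unshift A σ, mem_image_of_mem _ hσ, ?_⟩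
    refine edist_unshift_le A hα (hritz n τ x hxM hx0 hx) hσ.2.1 ?_
    rw [abs_sub_comm]
    exact hστ.le.trans hδr
  · rintro _ ⟨σ, hσ, rfl⟩
    obtain ⟨y, hy0, hy⟩ :=
      exists_eigenvector hRsa (hsep.mono hσfin (singleton_subset_iff.2 hσ.2)) hσ.1
    obtain ⟨τ, hτσ, x, hxM, hx0, hx⟩ := exists_ritz_near_spectrum hRsa hR1 h2 (by positivity)
      hδ0 hδ1 (by linarith) (hδα.trans hσ.2.1) (mem_eigSup_of_eigen hσ.2 hy) hy0 hy
    have hτα := hritz n τ x hxM hx0 hx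
    have hτ1 : τ ≤ 1 := by
      have h3 : ‖(τ : ℂ) • x‖ ≤ ‖x‖ := by
        rw [← hx]
        exact (Submodule.norm_starProjection_apply_le _ _).trans (hR1 x)
      rw [norm_smul, Complex.norm_real, Real.norm_eq_abs, abs_of_pos (hα.trans_le hτα)] at h3
      by_contra! h'
      have := norm_pos_iff.2 hx0
      nlinarith
    refine ⟨unshift A τ, (mem_galerkinSpec_iff hA hbelow).2
      ⟨τ, ⟨hα.trans_le hτα, hτ1⟩, rfl, x, hxM, hx0, hx⟩, ?_⟩
    refine edist_unshift_le A hα hσ.2.1 hτα ?_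
    rw [abs_sub_comm]
    exact hτσ.le.trans hδr

end Main

end GalerkinSpectral

end

open GalerkinSpectral in
theorem mainTheorem9 {H : Type*} [NormedAddCommGroup H] [InnerProductSpace ℂ H] [CompleteSpace H]
    (A : H →ₗ.[ℂ] H) (hA : IsSelfAdjoint A)
    (hbelow : ∃ c : ℝ, ∀ u : A.domain, c * ‖(u : H)‖ ^ 2 ≤ (inner ℂ (A u) (u : H)).re)
    (a b : ℝ) (hab : a < b) (ha : (a : ℂ) ∈ resSet A) (hb : (b : ℂ) ∈ resSet A)
    (hess : realPts (essSpec A) ∩ Icc a b = ∅)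
    (hne : (realPts (spec A) ∩ Icc a b).Nonempty)
    (L : ℕ → Submodule ℂ H) (hfin : ∀ n, FiniteDimensional ℂ (L n))
    (hdom : ∀ n, L n ≤ formDom A)
    (happrox : ∀ u : formDom A, ∃ v : ℕ → formDom A, (∀ n, (v n : H) ∈ L n) ∧
      Tendsto (fun n => formNorm A (u - v n)) atTop (𝓝 0)) :
    ∃ N : ℕ, ∀ k ≥ N, ∃ γ : ℝ, 0 < γ ∧
      IsLeast (realPts (discSpec (compressedProj A (Icc a b) (L k))) \ {0}) γ ∧
      Tendsto (fun n => symGap (fun x : H => ‖x‖)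
        (filteredSpace A (Icc a b) (L k) (L n) γ) (eigSpan A (Icc a b))) atTop (𝓝 0) ∧
      Tendsto (fun n => formSymGap A
        (filteredSpace A (Icc a b) (L k) (L n) γ) (eigSpan A (Icc a b))) atTop (𝓝 0) ∧
      Tendsto (fun n => Metric.hausdorffEDist
        (galerkinSpec A (filteredSpace A (Icc a b) (L k) (L n) γ))
        (realPts (spec A) ∩ Icc a b)) atTop (𝓝 0) := by
  obtain ⟨α, β, hα, hαβ, hασ, hβσ, hiff, hσfin, hEfin, hEeq, hσeq⟩ :=
    exists_window hA hbelow hab ha hb hess hne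
  set S := sqrtRes A with hS
  set R := shiftRes A with hR
  have hSsa : IsSelfAdjoint S := sqrtRes_isSelfAdjoint A
  have hRsa : IsSelfAdjoint R := shiftRes_isSelfAdjoint hA hbelow
  have hSinj : Function.Injective S := sqrtRes_injective hA hbelow
  have hSS : ∀ x, S (S x) = R x := sqrtRes_sqrtRes hA hbelow
  have hS1 : ∀ x, ‖S x‖ ≤ ‖x‖ := norm_sqrtRes_apply_le hA hbelow
  have hR1 : ∀ x, ‖R x‖ ≤ ‖x‖ := norm_shiftRes_apply_le hA hbelow
  have hinner : ∀ x, (inner ℂ (R x) x).re = ‖S x‖ ^ 2 := fun x => by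
    rw [norm_sqrtRes_sq hA hbelow, Complex.ofReal_re]
  have hsep : Separated R (Icc α β) := separated_Icc hασ hβσ
  set E := eigSup R (Icc α β) with hE
  have hmemE : ∀ {x}, specProj R (Icc α β) x = x ↔ x ∈ E := specProj_eq_self_iff hRsa hsep hσfin
  have hSE : ∀ u ∈ E, S u ∈ E := fun u hu => sqrtRes_mem_eigSup hA hbelow hu
  have hRE : ∀ u ∈ E, R u ∈ E := fun u hu => hSS u ▸ hSE _ (hSE u hu)
  have hES : ∀ u ∈ E, ∃ x ∈ E, S x = u := by
    intro u hu
    obtain ⟨w, hw, hwu, -⟩ := exists_preimage hRsa hsep (c := 0) hα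
      (by rintro x ⟨-, hx, -⟩; rw [sub_zero]; exact hx.trans (le_abs_self x)) (hmemE.2 hu)
    refine ⟨S w, hSE w (hmemE.1 hw), ?_⟩
    rw [hSS]; simpa using hwu
  have hEne : E ≠ ⊥ := by
    obtain ⟨μ, hμ⟩ := hne
    rw [hσeq] at hμ
    obtain ⟨τ, hτ, -⟩ := hμ
    obtain ⟨x, hx0, hx⟩ :=
      exists_eigenvector hRsa (hsep.mono hσfin (singleton_subset_iff.2 hτ.2)) hτ.1
    exact (Submodule.ne_bot_iff _).2 ⟨x, mem_eigSup_of_eigen hτ.2 hx, hx0⟩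
  -- the trial spaces in terms of `x = (A - m + 1)^{1/2} u`
  set K : ℕ → Submodule ℂ H := fun n => (L n).comap (S : H →ₗ[ℂ] H) with hK
  have hKfin : ∀ n, FiniteDimensional ℂ (K n) := fun n => finiteDimensional_comap hSinj (L n)
  have hKlim : ∀ x, Tendsto (fun n => (K n).starProjection x) atTop (𝓝 x) :=
    starProjection_comap_tendsto hA hbelow happrox
  set B : ℕ → H →L[ℂ] H := fun n => (K n).starProjection * R * (K n).starProjection with hB
  have hBsa : ∀ n, IsSelfAdjoint (B n) := fun n => compression_isSelfAdjoint hRsa (K n)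
  have hBfin : ∀ n, (spectrum ℝ (B n)).Finite := fun n =>
    finite_real_spectrum (finite_spectrum_of_range_le (K n)
      fun x => Submodule.starProjection_apply_mem _ _)
  have hBsep : ∀ n, Separated (B n) (Icc α β) := fun n => separated_of_finite (hBfin n) _
  set W : ℕ → Submodule ℂ H := fun n => eigSup (B n) (Icc α β) with hW
  have hmemW : ∀ {n x}, specProj (B n) (Icc α β) x = x ↔ x ∈ W n := fun {n x} =>
    specProj_eq_self_iff (hBsa n) (hBsep n) ((hBfin n).subset inter_subset_left)
  have hWK : ∀ n, W n ≤ K n := by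
    refine fun n => iSup₂_le fun τ hτ x hx => ?_
    have hx' : B n x = (τ : ℂ) • x := Module.End.mem_eigenspace_iff.1 hx
    have hτ0 : (τ : ℂ) ≠ 0 := by exact_mod_cast (hα.trans_le hτ.1).ne'
    have : x = (τ : ℂ)⁻¹ • B n x := by rw [hx', smul_smul, inv_mul_cancel₀ hτ0, one_smul]
    rw [this]
    exact (K n).smul_mem _ (Submodule.starProjection_apply_mem _ _)
  have hWfin : ∀ n, FiniteDimensional ℂ (W n) := fun n => Submodule.finiteDimensional_of_le (hWK n)
  have hWlow : ∀ n, ∀ y ∈ W n, α * ‖y‖ ^ 2 ≤ ‖S y‖ ^ 2 := by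
    intro n y hy
    have h1 := le_inner_of_specProj (hBsa n) hαβ.le (hBsep n) (hmemW.2 hy)
    have h2 : inner ℂ (B n y) y = inner ℂ (R y) y := by
      change inner ℂ ((K n).starProjection (R ((K n).starProjection y))) y = _
      rw [Submodule.inner_starProjection_left_eq_right,
        Submodule.starProjection_eq_self_iff.2 (hWK n hy)]
    rwa [h2, hinner] at h1
  have hElow : ∀ y ∈ E, α * ‖y‖ ^ 2 ≤ ‖S y‖ ^ 2 := by
    intro y hy
    have h1 := le_inner_of_specProj hRsa hαβ.le hsep (hmemE.2 hy)
    rwa [hinner] at h1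
  have hWE : ∀ x, Tendsto (fun n => (W n).starProjection x) atTop (𝓝 (E.starProjection x)) := by
    intro x
    have h := specProj_tendsto hRsa hBsa (compression_tendsto hKlim) hαβ hασ hβσ hBsep hσfin x
    rw [← starProjection_eigSup_apply hRsa hsep hσfin] at h
    refine h.congr fun n => ?_
    exact (starProjection_eigSup_apply (hBsa n) (hBsep n)
      ((hBfin n).subset inter_subset_left) x).symm
  set G : ℕ → Submodule ℂ H := fun n => (W n).map (S : H →ₗ[ℂ] H) with hG
  have hGfin : ∀ n, FiniteDimensional ℂ (G n) := fun n => inferInstanceAs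
    (FiniteDimensional ℂ ((W n).map (S : H →ₗ[ℂ] H)))
  have hGeq : ∀ n, galerkinSpan A (L n) (Icc a b) = G n := fun n =>
    galerkinSpan_eq hA hbelow hα hiff
  have hQ : ∀ x, Tendsto (fun n => (G n).starProjection x) atTop (𝓝 (E.starProjection x)) :=
    starProjection_map_tendsto hSsa hWE hSE hES hα hWlow
  -- for large `k`, the projection onto `L k` is injective on `E`
  obtain ⟨N, hN⟩ : ∃ N, ∀ k ≥ N, ∀ u ∈ E, (L k).starProjection u = 0 → u = 0 := by
    have h1 : ∀ u ∈ E, Tendsto (fun n => (1 - (L n).starProjection) u) atTop (𝓝 0) := by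
      intro u hu
      obtain ⟨x, -, rfl⟩ := hES u hu
      have h2 : Tendsto (fun n => ‖(K n).starProjection x - x‖) atTop (𝓝 0) :=
        tendsto_iff_norm_sub_tendsto_zero.1 (hKlim x)
      refine squeeze_zero_norm (fun n => ?_) h2
      have h3 : ‖S x - (L n).starProjection (S x)‖ ≤ ‖S x - S ((K n).starProjection x)‖ :=
        norm_sub_starProjection_le _ _ (Submodule.starProjection_apply_mem (K n) x)
      refine h3.trans ?_
      rw [← map_sub, norm_sub_rev _ x]
      exact hS1 _
    have h2 := eventually_norm_le_of_finiteDimensional E h1 (ε := 1 / 2) (by norm_num)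
    obtain ⟨N, hN⟩ := eventually_atTop.1 h2
    refine ⟨N, fun k hk u hu h0 => ?_⟩
    have h3 := hN k hk u hu
    rw [_root_.sub_apply, h0, sub_zero] at h3
    change ‖u‖ ≤ _ at h3
    exact norm_le_zero_iff.1 (by linarith)
  refine ⟨N, fun k hk => ?_⟩
  obtain ⟨γ, hγ0, hγ⟩ := exists_isLeast_filterOp hEne (hN k hk)
  have hγ' : IsLeast (realPts (discSpec (compressedProj A (Icc a b) (L k))) \ {0}) γ := by
    have : FiniteDimensional ℂ (eigSpan A (Icc a b)) := by rw [hEeq]; exact hEfin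
    rw [discSpec_compressedProj]
    convert hγ
  set M : ℕ → Submodule ℂ H := fun n => eigSup (filterOp (G n) (L k)) (Icc (γ / 2) 1) with hM
  have h0γ : (0 : ℝ) ∉ Icc (γ / 2) 1 := by
    rintro ⟨h, -⟩
    linarith
  have hMeq : ∀ n, filteredSpace A (Icc a b) (L k) (L n) γ = M n := by
    intro n
    rw [filteredSpace, hGeq]
    exact eigSpan_restrict_eq (G n) (L k) h0γ
  have hMG : ∀ n, M n ≤ G n := fun n => eigSup_filterOp_le h0γ
  have hclose : ∀ ε > 0, ∀ᶠ n in atTop, SubClose (M n) E ε ∧ SubClose E (M n) ε := fun ε hε =>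
    filterOp_subClose hQ (hN k hk) hγ0 hγ hε
  set C := √α⁻¹ with hC
  have hClow : ∀ y : H, α * ‖y‖ ^ 2 ≤ ‖S y‖ ^ 2 → ‖y‖ ≤ C * ‖S y‖ := by
    intro y hy
    refine abs_le_of_sq_le_sq' ?_ (by positivity) |>.2
    rw [mul_pow, hC, Real.sq_sqrt (by positivity), inv_mul_eq_div, le_div_iff₀ hα]
    linarith
  have hclose' : ∀ ε > 0, ∀ᶠ n in atTop, 
      SubClose ((M n).comap (S : H →ₗ[ℂ] H)) E ε ∧
      SubClose E ((M n).comap (S : H →ₗ[ℂ] H)) ε :=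
    fun ε hε => subClose_comap hSinj hS1
      (fun x hx => by
        have := hWE x
        rwa [Submodule.starProjection_eq_self_iff.2 hx] at this)
      hSE hES (Real.sqrt_nonneg _) (fun n y hy => hClow y (hWlow n y hy))
      (fun y hy => hClow y (hElow y hy)) hMG hclose hε
  refine ⟨γ, hγ0, hγ', ?_⟩
  simp only [hMeq, hEeq, hσeq]
  refine ⟨?_, ?_, ?_⟩
  · exact tendsto_symGap (fun x => norm_nonneg x) hclose
  · exact tendsto_formSymGap hA hbelow hSE hES hclose'
  · have hMfin : ∀ n, FiniteDimensional ℂ (M n) := fun n =>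
      Submodule.finiteDimensional_of_le (hMG n)
    refine tendsto_hausdorffEDist_galerkinSpec hA hbelow hα hασ hβσ hσfin (fun n x hx => ?_) hclose'
    obtain ⟨w, hw, hwx⟩ := hMG n hx
    exact hWlow n x (hSinj hwx ▸ hw)
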